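/- Let $\mathcal A$ be a finite arrangement of (affine) hyperplanes in $\mathbb C^\ell$, let $H\in\mathcal A$, and let $(\mathcal A,\mathcal A',\mathcal A'')$ be the associated deletion–restriction triple: $\mathcal A'=\mathcal A\setminus\{H\}$, and $\mathcal A''$ is the arrangement in $H$ of all nonempty intersections $K\cap H$ with $K\in\mathcal A'$. Let $M$ and $M'$ be the complements in $\mathbb C^\ell$ of the unions of the hyperplanes of $\mathcal A$ and $\mathcal A'$, and let $M''$ be the complement in $H$ of the union of the hyperplanes of $\mathcal A''$, so that $M=M'\setminus(M'\cap H)$ and $M''=M'\cap H$. Let $i:M\to M'$ and $j:M''\to M'$ be the inclusions. Let $\mathcal L'$ be a complex rank-one local system on $M'$, and put $\mathcal L=i^*\mathcal L'$ and $\mathcal L''=j^*\mathcal L'$. Then there is a long exact sequence of complex vector spaces in local system cohomology $$\cdots\to H^{q}(M';\mathcal L')\xrightarrow{\,i^*\,}H^{q}(M;\mathcal L)\to H^{q-1}(M'';\mathcal L'')\to H^{q+1}(M';\mathcal L')\xrightarrow{\,i^*\,}H^{q+1}(M;\mathcal L)\to\cdots$$ in which $i^*$ is the map induced by the inclusion $i$.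 Here all cohomology in negative degrees is zero, so that $i^*$ is an isomorphism in degree $0$ and is injective in degree $1$. -/

import Mathlib

open CategoryTheory

noncomputable section

universe u

/-! ### Local systems -/

/-- A complex local system on `X`: a functor from the fundamental groupoid of `X` to complex vector
spaces. It has a fibre `L_x` over each point `x`, and each homotopy class (relative to the
endpoints) of paths from `x` to `y` acts by an isomorphism `L_x → L_y`. -/
abbrev LocalSystem (X : Type u) [TopologicalSpace X] : Type (u + 1) :=
  FundamentalGroupoid X ⥤ ModuleCat.{u} ℂ

namespace LocalSystem

/-- The local system has rank one: all its fibres are one-dimensional. -/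
def IsRankOne {X : Type u} [TopologicalSpace X] (L : LocalSystem X) : Prop :=
  ∀ x : X, Module.finrank ℂ (L.obj (FundamentalGroupoid.mk x)) = 1

/-- The pullback `f^* L` of a local system along a continuous map. -/
abbrev pullback {X Y : Type u} [TopologicalSpace X] [TopologicalSpace Y] (f : C(X, Y))
    (L : LocalSystem Y) : LocalSystem X :=
  FundamentalGroupoid.map f ⋙ L

/-! ### Singular cohomology with coefficients in a local system -/

/-- The standard topological `n`-simplex. -/
abbrev Simplex (n : SimplexCategory) : Type := stdSimplex ℝ (Fin (n.len + 1))

/-- The initial vertex `v₀` of the standard simplex. -/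
abbrev initialVertex (n : SimplexCategory) : Simplex n := stdSimplex.vertex 0

/-- The affine map between standard simplices induced by a monotone map of the vertices. -/
abbrev simplexMap {m n : SimplexCategory} (θ : m ⟶ n) : C(Simplex m, Simplex n) :=
  ⟨stdSimplex.map θ, stdSimplex.continuous_map θ⟩

instance (n : SimplexCategory) : SimplyConnectedSpace (Simplex n) :=
  have : ContractibleSpace (Simplex n) :=
    (convex_stdSimplex ℝ (Fin (n.len + 1))).contractibleSpace
      ⟨_, single_mem_stdSimplex ℝ (0 : Fin (n.len + 1))⟩
  inferInstance

instance (n : SimplexCategory) (a b : FundamentalGroupoid (Simplex n)) : Subsingleton (a ⟶ b) :=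
  inferInstanceAs (Subsingleton (Path.Homotopic.Quotient a.as b.as))

/-- The class of the paths from `a` to `b` in the standard simplex; there is only one. -/
def simplexPath {n : SimplexCategory} (a b : Simplex n) :
    FundamentalGroupoid.mk a ⟶ FundamentalGroupoid.mk b :=
  Path.Homotopic.Quotient.mk (PathConnectedSpace.somePath a b)

variable {X : Type u} [TopologicalSpace X]

/-- Parallel transport `L_{σ(a)} → L_{σ(b)}` inside the singular simplex `σ`. -/
def transport (L : LocalSystem X) {n : SimplexCategory} (σ : C(Simplex n, X)) (a b : Simplex n) :
    L.obj (FundamentalGroupoid.mk (σ a)) →ₗ[ℂ] L.obj (FundamentalGroupoid.mk (σ b)) :=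
  (L.map ((FundamentalGroupoid.map σ).map (simplexPath a b))).hom

theorem transport_self (L : LocalSystem X) {n : SimplexCategory} (σ : C(Simplex n, X))
    (a : Simplex n) (x) : L.transport σ a a x = x := by
  have : simplexPath a a = 𝟙 _ := Subsingleton.elim _ _
  simp only [transport, this, CategoryTheory.Functor.map_id]
  rfl

theorem transport_trans (L : LocalSystem X) {n : SimplexCategory} (σ : C(Simplex n, X))
    (a b c : Simplex n) (x) :
    L.transport σ b c (L.transport σ a b x) = L.transport σ a c x := by
  have : simplexPath a c = simplexPath a b ≫ simplexPath b c := Subsingleton.elim _ _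
  simp only [transport, this, Functor.map_comp]
  rfl

theorem transport_comp (L : LocalSystem X) {m n : SimplexCategory} (σ : C(Simplex n, X))
    (e : C(Simplex m, Simplex n)) (a b : Simplex m) (x) :
    L.transport (σ.comp e) a b x = L.transport σ (e a) (e b) x := by
  have h1 : simplexPath (e a) (e b) = (FundamentalGroupoid.map e).map (simplexPath a b) :=
    Subsingleton.elim _ _
  simp only [transport, h1]
  rfl

theorem transport_pullback {Y : Type u} [TopologicalSpace Y] (f : C(X, Y)) (L : LocalSystem Y)
    {n : SimplexCategory} (σ : C(Simplex n, X)) (a b : Simplex n) (x) :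
    (L.pullback f).transport σ a b x = L.transport (f.comp σ) a b x := by
  rfl

/-- Singular `n`-cochains on `X` with coefficients in `L`: functions assigning to each singular
`n`-simplex `σ` an element of the fibre of `L` over the initial vertex of `σ`. -/
abbrev Cochain (L : LocalSystem X) (n : SimplexCategory) : Type u :=
  ∀ σ : C(Simplex n, X), L.obj (FundamentalGroupoid.mk (σ (initialVertex n)))

/-- The map on cochains induced by a monotone map `θ` of vertices: evaluate the cochain on `σ ∘ θ`,
then transport the value to the initial vertex of `σ` along `σ`. -/
def cochainMap (L : LocalSystem X) {m n : SimplexCategory} (θ : m ⟶ n) :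
    L.Cochain m →ₗ[ℂ] L.Cochain n :=
  LinearMap.pi fun σ =>
    (L.transport σ (simplexMap θ (initialVertex m)) (initialVertex n)).comp
      (LinearMap.proj (σ.comp (simplexMap θ)))

theorem cochainMap_apply (L : LocalSystem X) {m n : SimplexCategory} (θ : m ⟶ n)
    (c : L.Cochain m) (σ : C(Simplex n, X)) :
    L.cochainMap θ c σ = L.transport σ (simplexMap θ (initialVertex m)) (initialVertex n)
      (c (σ.comp (simplexMap θ))) := rfl

theorem transport_congr (L : LocalSystem X) {m n : SimplexCategory} (c : L.Cochain m)
    (σ : C(Simplex n, X)) (e e' : C(Simplex m, Simplex n)) (h : e = e') (b : Simplex n) :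
    L.transport σ (e (initialVertex m)) b (c (σ.comp e)) =
      L.transport σ (e' (initialVertex m)) b (c (σ.comp e')) := by
  subst h; rfl

theorem simplexMap_id (n : SimplexCategory) : simplexMap (𝟙 n) = ContinuousMap.id _ := by
  ext1 x
  exact stdSimplex.map_id_apply x

theorem simplexMap_comp {k m n : SimplexCategory} (θ : k ⟶ m) (η : m ⟶ n) :
    simplexMap (θ ≫ η) = (simplexMap η).comp (simplexMap θ) := by
  ext1 x
  exact (stdSimplex.map_comp_apply θ η x).symm

/-- The cosimplicial vector space of singular cochains with coefficients in `L`. -/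
def cosimplicialCochains (L : LocalSystem X) : CosimplicialObject (ModuleCat.{u} ℂ) where
  obj n := ModuleCat.of ℂ (L.Cochain n)
  map θ := ModuleCat.ofHom (L.cochainMap θ)
  map_id n := by
    ext c σ
    change L.cochainMap (𝟙 n) c σ = c σ
    rw [cochainMap_apply, transport_congr L c σ _ _ (simplexMap_id n)]
    exact L.transport_self σ _ _
  map_comp {k m n} θ η := by
    ext c σ
    change L.cochainMap (θ ≫ η) c σ = L.cochainMap η (L.cochainMap θ c) σ
    rw [cochainMap_apply, transport_congr L c σ _ _ (simplexMap_comp θ η), cochainMap_apply,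
      cochainMap_apply, transport_comp]
    exact (L.transport_trans σ _ _ _ _).symm

/-- The singular cochain complex of `X` with coefficients in `L`. Its differential is the
alternating sum over the faces of a simplex. -/
def cochainComplex (L : LocalSystem X) : CochainComplex (ModuleCat.{u} ℂ) ℕ :=
  (AlgebraicTopology.alternatingCofaceMapComplex (ModuleCat.{u} ℂ)).obj L.cosimplicialCochains

/-- The local system cohomology `H^q(X; L)`. -/
def cohomology (L : LocalSystem X) (q : ℕ) : ModuleCat.{u} ℂ := L.cochainComplex.homology q

/-- The pullback of cochains along a continuous map `f`: `(f^* c)(σ) = c(f ∘ σ)`. -/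
def cochainPullback {Y : Type u} [TopologicalSpace Y] (f : C(X, Y)) (L : LocalSystem Y) :
    L.cosimplicialCochains ⟶ (L.pullback f).cosimplicialCochains where
  app _ := ModuleCat.ofHom
    { toFun := fun c σ => c (f.comp σ)
      map_add' := fun _ _ => rfl
      map_smul' := fun _ _ => rfl }
  naturality _ _ _ := rfl

/-- The map `f^* : H^q(Y; L) → H^q(X; f^* L)` induced by a continuous map `f : X → Y`. -/
def cohomologyPullback {Y : Type u} [TopologicalSpace Y] (f : C(X, Y)) (L : LocalSystem Y)
    (q : ℕ) : L.cohomology q →ₗ[ℂ] (L.pullback f).cohomology q :=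
  (HomologicalComplex.homologyMap
    ((AlgebraicTopology.alternatingCofaceMapComplex (ModuleCat.{u} ℂ)).map
      (cochainPullback f L)) q).hom

end LocalSystem

/-! ### Hyperplane arrangements and triples -/

/-- A (finite, affine, not necessarily central) arrangement of hyperplanes in an affine subspace
`W` of `ℂ^ℓ`. -/
structure Arrangement {ℓ : ℕ} (W : AffineSubspace ℂ (Fin ℓ → ℂ)) where
  /-- The hyperplanes of the arrangement. -/
  hyperplanes : Set (AffineSubspace ℂ (Fin ℓ → ℂ))
  finite : hyperplanes.Finite
  le : ∀ K ∈ hyperplanes, K ≤ W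
  nonempty : ∀ K ∈ hyperplanes, (K : Set (Fin ℓ → ℂ)).Nonempty
  codim_one : ∀ K ∈ hyperplanes,
    Module.finrank ℂ K.direction + 1 = Module.finrank ℂ W.direction

namespace Arrangement

variable {ℓ : ℕ}

/-- The complement of the arrangement in the ambient affine space `W`. -/
def complement {W : AffineSubspace ℂ (Fin ℓ → ℂ)} (A : Arrangement W) : Set (Fin ℓ → ℂ) :=
  (W : Set (Fin ℓ → ℂ)) \ ⋃ K ∈ A.hyperplanes, (K : Set (Fin ℓ → ℂ))

/-- The deletion `A' = A \ {H}`. -/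
def deletion {W : AffineSubspace ℂ (Fin ℓ → ℂ)} (A : Arrangement W)
    (H : AffineSubspace ℂ (Fin ℓ → ℂ)) : Arrangement W where
  hyperplanes := A.hyperplanes \ {H}
  finite := A.finite.subset Set.sdiff_subset
  le K hK := A.le K hK.1
  nonempty K hK := A.nonempty K hK.1
  codim_one K hK := A.codim_one K hK.1

/-- The restriction `A''` of an arrangement in `ℂ^ℓ` to one of its hyperplanes `H`: the arrangement
in `H` of all nonempty intersections `K ∩ H` with `K ∈ A' = A \ {H}`. -/
def restriction (A : Arrangement (⊤ : AffineSubspace ℂ (Fin ℓ → ℂ)))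
    (H : AffineSubspace ℂ (Fin ℓ → ℂ)) (hH : H ∈ A.hyperplanes) : Arrangement H where
  hyperplanes := {S | ∃ K ∈ (A.deletion H).hyperplanes,
    S = K ⊓ H ∧ (S : Set (Fin ℓ → ℂ)).Nonempty}
  finite := by
    refine ((A.deletion H).finite.image fun K => K ⊓ H).subset ?_
    rintro S ⟨K, hK, rfl, -⟩
    exact ⟨K, hK, rfl⟩
  le := by
    rintro S ⟨K, -, rfl, -⟩
    exact inf_le_right
  nonempty := by
    rintro S ⟨K, -, -, h⟩
    exact h
  codim_one := by
    rintro S ⟨K, hK, rfl, p, hp⟩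
    have hpK : p ∈ K := hp.1
    have hpH : p ∈ H := hp.2
    have h1 := A.codim_one K hK.1
    have h2 := A.codim_one H hH
    rw [AffineSubspace.direction_inf_of_mem hpK hpH]
    have h3 := Submodule.finrank_sup_add_finrank_inf_eq K.direction H.direction
    rw [AffineSubspace.direction_top] at h1 h2
    have h4 : K.direction < K.direction ⊔ H.direction := by
      refine lt_of_le_of_ne le_sup_left fun h => hK.2 ?_
      have h5 : H.direction ≤ K.direction := by
        rw [h]
        exact le_sup_right
      have h6 := Submodule.eq_of_le_of_finrank_eq h5 (by omega)
      exact AffineSubspace.ext_of_direction_eq h6.symm ⟨p, hpK, hpH⟩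
    have h7 := Submodule.finrank_lt_finrank_of_lt h4
    have h8 := Submodule.finrank_mono (le_top : K.direction ⊔ H.direction ≤ ⊤)
    omega

/-- `M = M' \ H`. -/
theorem complement_eq (A : Arrangement (⊤ : AffineSubspace ℂ (Fin ℓ → ℂ)))
    (H : AffineSubspace ℂ (Fin ℓ → ℂ)) (hH : H ∈ A.hyperplanes) :
    A.complement = (A.deletion H).complement \ (H : Set (Fin ℓ → ℂ)) := by
  ext x
  simp only [complement, deletion, Set.mem_sdiff, Set.mem_iUnion, Set.mem_singleton_iff,
    SetLike.mem_coe, not_exists]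
  constructor
  · rintro ⟨h1, h2⟩
    exact ⟨⟨h1, fun K hK => h2 K hK.1⟩, h2 H hH⟩
  · rintro ⟨⟨h1, h2⟩, h3⟩
    refine ⟨h1, fun K hK hx => ?_⟩
    by_cases h : K = H
    · exact h3 (h ▸ hx)
    · exact h2 K ⟨hK, h⟩ hx

/-- `M'' = M' ∩ H`. -/
theorem complement_restriction_eq (A : Arrangement (⊤ : AffineSubspace ℂ (Fin ℓ → ℂ)))
    (H : AffineSubspace ℂ (Fin ℓ → ℂ)) (hH : H ∈ A.hyperplanes) :
    (A.restriction H hH).complement = (A.deletion H).complement ∩ (H : Set (Fin ℓ → ℂ)) := by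
  ext x
  simp only [complement, restriction, Set.mem_sdiff, Set.mem_iUnion, Set.mem_inter_iff,
    SetLike.mem_coe, not_exists]
  constructor
  · rintro ⟨h1, h2⟩
    exact ⟨⟨AffineSubspace.mem_top _ _ _,
      fun K hK hx => h2 (K ⊓ H) ⟨K, hK, rfl, x, hx, h1⟩ ⟨hx, h1⟩⟩, h1⟩
  · rintro ⟨⟨-, h2⟩, h3⟩
    refine ⟨h3, ?_⟩
    rintro S ⟨K, hK, rfl, -⟩ hx
    exact h2 K hK hx.1

/-- The inclusion `i : M → M'`. -/
def inclusionDeletion (A : Arrangement (⊤ : AffineSubspace ℂ (Fin ℓ → ℂ)))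
    (H : AffineSubspace ℂ (Fin ℓ → ℂ)) (hH : H ∈ A.hyperplanes) :
    C(A.complement, (A.deletion H).complement) :=
  ContinuousMap.inclusion ((A.complement_eq H hH).trans_subset Set.sdiff_subset)

/-- The inclusion `j : M'' → M'`. -/
def inclusionRestriction (A : Arrangement (⊤ : AffineSubspace ℂ (Fin ℓ → ℂ)))
    (H : AffineSubspace ℂ (Fin ℓ → ℂ)) (hH : H ∈ A.hyperplanes) :
    C((A.restriction H hH).complement, (A.deletion H).complement) :=
  ContinuousMap.inclusion ((A.complement_restriction_eq H hH).trans_subset Set.inter_subset_left)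

end Arrangement

end

/-! The sequence is the long exact cohomology sequence of the pair `(M', M)` in which `H^(q+2)(M',
M; L')` is replaced by `H^q(M''; L'')`. The substance is this Thom isomorphism, together with the
vanishing of the relative groups in degrees 0 and 1, which gives the two statements at the start of
the sequence (`relComplex_thom`, `gysin_exact`).

The hyperplane is the zero set of an affine form, so moving each point `z` of `M''` in one fixed
transversal direction, by less than the distance from `z` to the complement of `M'`, embeds `M'' ×
ℂ` as an open neighbourhood of `M''` in `M'` (`exists_tubular_neighbourhood`). Excision then
replaces the pair `(M', M)` by `(Z × ℂ, Z × ℂ^*)` with `Z = M''`.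

For this pair no Thom class is needed. Cohomology relative to `Z × D` vanishes when `D` is
star-shaped, by contracting the fibres. Now `ℂ^*` is the union of two opposite slit planes, their
intersection is the union of the open upper and lower half-planes, and these are disjoint. All four
sets are star-shaped, so relative Mayer–Vietoris, applied twice, lowers the degree by two and ends
at the cohomology relative to the empty set, that is, at `H^*(Z × ℂ) ≅ H^*(Z)`.

Relative cohomology is computed by `relComplex 𝒰`, the cochains that vanish on every simplex lying
in a member of `𝒰`. Two acyclicity theorems carry the argument: `relComplex_acyclic_of_cover`
(subdivision into small simplices, hence excision) and `relComplex_acyclic_of_deformation` (homotopy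
invariance). In both, a cochain is evaluated on affine simplices of a convex set mapped to the
space, and the values are transported to one fibre. What remains is a statement about functions on
tuples of points with values in a fixed group, where all homotopies are built from cones. -/

open CategoryTheory

noncomputable section

universe u

/-! ### Cochains on tuples of points -/

/-- Functions on the `n`-tuples of elements of `K`, thought of as (augmented) cochains on the full
simplicial set on `K`; an `n`-tuple spans a simplex of dimension `n - 1`. -/
abbrev TupleCochain (K V : Type*) (n : ℕ) : Type _ := (Fin n → K) → V

namespace TupleCochain

variable {K K' K₂ K₂' V W : Type*} [AddCommGroup V] [AddCommGroup W] {n : ℕ}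

/-- The coboundary of a tuple cochain. -/
def d : TupleCochain K V n →+ TupleCochain K V (n + 1) where
  toFun φ v := ∑ i : Fin (n + 1), (-1 : ℤ) ^ (i : ℕ) • φ (v ∘ i.succAbove)
  map_zero' := by ext v; simp
  map_add' φ ψ := by ext v; simp [Finset.sum_add_distrib]

theorem d_apply (φ : TupleCochain K V n) (v : Fin (n + 1) → K) :
    d φ v = ∑ i : Fin (n + 1), (-1 : ℤ) ^ (i : ℕ) • φ (v ∘ i.succAbove) := rfl

/-- The tuple `(a, v₀, v₁, …)`. -/
def cons (a : K) (v : Fin n → K) : Fin (n + 1) → K := Fin.cons a v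

/-- The slice `v ↦ φ (a, v)` of a tuple cochain. -/
def slice (a : K) : TupleCochain K V (n + 1) →+ TupleCochain K V n where
  toFun φ v := φ (cons a v)
  map_zero' := rfl
  map_add' _ _ := rfl

theorem slice_apply (a : K) (φ : TupleCochain K V (n + 1)) (v : Fin n → K) :
    slice a φ v = φ (cons a v) := rfl

theorem cons_zero_comp_tail (v : Fin (n + 1) → K) : cons (v 0) (v ∘ Fin.succ) = v :=
  Fin.cons_self_tail v

theorem comp_cons (f : K → K') (a : K) (v : Fin n → K) : f ∘ cons a v = cons (f a) (f ∘ v) := by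
  ext i
  refine Fin.cases rfl (fun i => rfl) i

theorem cons_comp_succAbove_succ (a : K) (v : Fin (n + 1) → K) (i : Fin (n + 1)) :
    cons a v ∘ i.succ.succAbove = cons a (v ∘ i.succAbove) := by
  ext j
  refine Fin.cases ?_ (fun j => ?_) j
  · simp [cons]
  · simp [cons]

theorem slice_d_zero (a : K) (φ : TupleCochain K V 0) : slice a (d φ) = φ := by
  ext v
  rw [slice_apply, d_apply, Fin.sum_univ_succ, Fin.sum_univ_zero, add_zero, Fin.val_zero, pow_zero,
    one_smul]
  exact congrArg φ (Subsingleton.elim _ _)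

/-- Dual to `∂(a * v) = v - a * ∂v`: coning with any apex contracts the complex. Every later
homotopy formula is deduced from this identity. -/
theorem slice_d_succ (a : K) (φ : TupleCochain K V (n + 1)) :
    slice a (d φ) = φ - d (slice a φ) := by
  ext v
  rw [slice_apply, d_apply, Fin.sum_univ_succ]
  simp only [cons_comp_succAbove_succ, Pi.sub_apply, d_apply, slice_apply, Fin.val_succ, pow_succ,
    mul_neg, mul_one, neg_smul, Finset.sum_neg_distrib]
  simp only [Fin.val_zero, pow_zero, one_smul, sub_eq_add_neg]
  congr 1

/-- Slicing at any apex and using the cone formula twice reduces the claim to one degree lower. This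
suffices because each tuple is the cone from its first entry over the rest. -/
theorem d_d (φ : TupleCochain K V n) : d (d φ) = 0 := by
  induction n with
  | zero =>
    ext v
    have h : slice (v 0) (d (d φ)) = 0 := by rw [slice_d_succ, slice_d_zero, sub_self]
    rw [← cons_zero_comp_tail v]
    exact congrFun h _
  | succ n ih =>
    ext v
    have h : slice (v 0) (d (d φ)) = 0 := by
      rw [slice_d_succ, slice_d_succ, map_sub, ih, sub_zero, sub_self]
    rw [← cons_zero_comp_tail v]
    exact congrFun h _

/-- The pullback of tuple cochains along a map of the underlying sets. -/
def comap (f : K → K₂) : TupleCochain K₂ V n →+ TupleCochain K V n where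
  toFun φ v := φ (f ∘ v)
  map_zero' := rfl
  map_add' _ _ := rfl

/-- The homotopy between two maps `Φ`, `Ψ` of tuple cochains, built inductively by taking cones
with apex `a v`. -/
def coneHomotopy (Φ Ψ : ∀ n, TupleCochain K₂ V n →+ TupleCochain K V n)
    (a : ∀ n, (Fin (n + 1) → K) → K₂) : ∀ n, TupleCochain K₂ V (n + 1) →+ TupleCochain K V n
  | 0 => 0
  | n + 1 =>
    { toFun φ v := Φ (n + 1) (slice (a n v) φ) v - Ψ (n + 1) (slice (a n v) φ) v -
        d (coneHomotopy Φ Ψ a n (slice (a n v) φ)) v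
      map_zero' := by ext v; simp
      map_add' φ ψ := by ext v; simp only [map_add, Pi.add_apply]; abel }

theorem coneHomotopy_succ_apply (Φ Ψ : ∀ n, TupleCochain K₂ V n →+ TupleCochain K V n)
    (a : ∀ n, (Fin (n + 1) → K) → K₂) (φ : TupleCochain K₂ V (n + 2)) (v : Fin (n + 1) → K) :
    coneHomotopy Φ Ψ a (n + 1) φ v = Φ (n + 1) (slice (a n v) φ) v -
      Ψ (n + 1) (slice (a n v) φ) v - d (coneHomotopy Φ Ψ a n (slice (a n v) φ)) v := rfl

/-- Once the cone formula has been applied to the slice of `d φ`, the induction hypothesis and `d ∘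
d = 0` cancel all terms other than `Φ φ - Ψ φ`. The apexes are arbitrary and may vary with the
tuple. Agreement of `Φ` and `Ψ` on the augmentation term starts the induction. -/
theorem coneHomotopy_d (Φ Ψ : ∀ n, TupleCochain K₂ V n →+ TupleCochain K V n)
    (hΦ : ∀ n (φ : TupleCochain K₂ V n), Φ (n + 1) (d φ) = d (Φ n φ))
    (hΨ : ∀ n (φ : TupleCochain K₂ V n), Ψ (n + 1) (d φ) = d (Ψ n φ)) (h0 : Φ 0 = Ψ 0)
    (a : ∀ n, (Fin (n + 1) → K) → K₂) (φ : TupleCochain K₂ V (n + 1)) :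
    coneHomotopy Φ Ψ a (n + 1) (d φ) + d (coneHomotopy Φ Ψ a n φ) =
      Φ (n + 1) φ - Ψ (n + 1) φ := by
  induction n with
  | zero =>
    ext v
    have h : ∀ s : TupleCochain K₂ V 1, coneHomotopy Φ Ψ a 0 s = 0 := fun _ => rfl
    rw [Pi.add_apply, coneHomotopy_succ_apply, slice_d_succ]
    simp only [Pi.sub_apply, map_sub, hΦ, hΨ, h0, h, map_zero, Pi.zero_apply]
    abel
  | succ n ih =>
    ext v
    have h := fun s => eq_sub_of_add_eq (ih s)
    rw [Pi.add_apply, coneHomotopy_succ_apply, slice_d_succ]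
    simp only [Pi.sub_apply, map_sub, hΦ, hΨ, h, d_d, Pi.zero_apply]
    abel

/-- The (dual) barycentric subdivision operator, for a choice `β` of barycentres. -/
def sd (β : ∀ n, (Fin (n + 1) → K) → K) : ∀ n, TupleCochain K V n →+ TupleCochain K V n
  | 0 => AddMonoidHom.id _
  | n + 1 =>
    { toFun φ v := d (sd β n (slice (β n v) φ)) v
      map_zero' := by ext v; simp
      map_add' φ ψ := by ext v; simp only [map_add, Pi.add_apply] }

theorem sd_succ_apply (β : ∀ n, (Fin (n + 1) → K) → K) (φ : TupleCochain K V (n + 1))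
    (v : Fin (n + 1) → K) : sd β (n + 1) φ v = d (sd β n (slice (β n v) φ)) v := rfl

theorem sd_d (β : ∀ n, (Fin (n + 1) → K) → K) (φ : TupleCochain K V n) :
    sd β (n + 1) (d φ) = d (sd β n φ) := by
  induction n with
  | zero => ext v; rw [sd_succ_apply, slice_d_zero]
  | succ n ih =>
    ext v
    rw [sd_succ_apply, slice_d_succ, map_sub, ih, map_sub, d_d, sub_zero]

theorem sd_iterate_d (β : ∀ n, (Fin (n + 1) → K) → K) (k : ℕ) (φ : TupleCochain K V n) :
    (sd β (n + 1))^[k] (d φ) = d ((sd β n)^[k] φ) :=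
  ((Function.Semiconj.iterate_right (f := (d : TupleCochain K V n → _)) fun φ => (sd_d β φ).symm)
    k φ).symm

/-- The homotopy between the identity and the subdivision operator. -/
def sdHomotopy (β : ∀ n, (Fin (n + 1) → K) → K) (n : ℕ) :
    TupleCochain K V (n + 1) →+ TupleCochain K V n :=
  coneHomotopy (fun _ => AddMonoidHom.id _) (sd β) β n

theorem sdHomotopy_d (β : ∀ n, (Fin (n + 1) → K) → K) (φ : TupleCochain K V (n + 1)) :
    sdHomotopy β (n + 1) (d φ) + d (sdHomotopy β n φ) = φ - sd β (n + 1) φ :=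
  coneHomotopy_d (fun _ => AddMonoidHom.id _) _ (fun _ _ => rfl) (fun _ φ => sd_d β φ) rfl β φ

/-! Naturality of the operators, simultaneously in the set of points and in the coefficients. -/

theorem d_natural (g : V →+ W) (f : K → K') {φ : TupleCochain K V n} {ψ : TupleCochain K' W n}
    (h : ∀ v, g (φ v) = ψ (f ∘ v)) (v : Fin (n + 1) → K) : g (d φ v) = d ψ (f ∘ v) := by
  simp only [d_apply, map_sum, map_zsmul, h]
  rfl

theorem slice_natural (g : V →+ W) (f : K → K') {φ : TupleCochain K V (n + 1)}
    {ψ : TupleCochain K' W (n + 1)} (h : ∀ v, g (φ v) = ψ (f ∘ v)) (a : K) (v : Fin n → K) :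
    g (slice a φ v) = slice (f a) ψ (f ∘ v) := by
  rw [slice_apply, h, comp_cons]
  rfl

theorem sd_natural (g : V →+ W) (f : K → K') {β : ∀ n, (Fin (n + 1) → K) → K}
    {β' : ∀ n, (Fin (n + 1) → K') → K'} (hβ : ∀ n v, f (β n v) = β' n (f ∘ v))
    {φ : TupleCochain K V n} {ψ : TupleCochain K' W n} (h : ∀ v, g (φ v) = ψ (f ∘ v))
    (v : Fin n → K) : g (sd β n φ v) = sd β' n ψ (f ∘ v) := by
  induction n with
  | zero => exact h v
  | succ n ih =>
    rw [sd_succ_apply, sd_succ_apply, ← hβ]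
    exact d_natural g f (fun w => ih (slice_natural g f h _) w) v

theorem sd_iterate_natural (g : V →+ W) (f : K → K') {β : ∀ n, (Fin (n + 1) → K) → K}
    {β' : ∀ n, (Fin (n + 1) → K') → K'} (hβ : ∀ n v, f (β n v) = β' n (f ∘ v))
    {φ : TupleCochain K V n} {ψ : TupleCochain K' W n} (h : ∀ v, g (φ v) = ψ (f ∘ v)) (k : ℕ)
    (v : Fin n → K) : g ((sd β n)^[k] φ v) = (sd β' n)^[k] ψ (f ∘ v) := by
  induction k generalizing v with
  | zero => exact h v
  | succ k ih =>
    rw [Function.iterate_succ_apply', Function.iterate_succ_apply']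
    exact sd_natural g f hβ ih v

theorem coneHomotopy_natural (g : V →+ W) (f : K → K') (f₂ : K₂ → K₂')
    {Φ Ψ : ∀ n, TupleCochain K₂ V n →+ TupleCochain K V n}
    {Φ' Ψ' : ∀ n, TupleCochain K₂' W n →+ TupleCochain K' W n}
    (hΦ : ∀ n (φ : TupleCochain K₂ V n) (ψ : TupleCochain K₂' W n),
      (∀ v, g (φ v) = ψ (f₂ ∘ v)) → ∀ v, g (Φ n φ v) = Φ' n ψ (f ∘ v))
    (hΨ : ∀ n (φ : TupleCochain K₂ V n) (ψ : TupleCochain K₂' W n),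
      (∀ v, g (φ v) = ψ (f₂ ∘ v)) → ∀ v, g (Ψ n φ v) = Ψ' n ψ (f ∘ v))
    {a : ∀ n, (Fin (n + 1) → K) → K₂} {a' : ∀ n, (Fin (n + 1) → K') → K₂'}
    (ha : ∀ n v, f₂ (a n v) = a' n (f ∘ v))
    {φ : TupleCochain K₂ V (n + 1)} {ψ : TupleCochain K₂' W (n + 1)}
    (h : ∀ v, g (φ v) = ψ (f₂ ∘ v)) (v : Fin n → K) :
    g (coneHomotopy Φ Ψ a n φ v) = coneHomotopy Φ' Ψ' a' n ψ (f ∘ v) := by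
  induction n with
  | zero => exact map_zero g
  | succ n ih =>
    have hs := fun w => slice_natural g f₂ h (a n v) w
    rw [ha] at hs
    rw [coneHomotopy_succ_apply, coneHomotopy_succ_apply, map_sub, map_sub, hΦ _ _ _ hs,
      hΨ _ _ _ hs, d_natural g f (fun w => ih hs w)]

theorem sdHomotopy_natural (g : V →+ W) (f : K → K') {β : ∀ n, (Fin (n + 1) → K) → K}
    {β' : ∀ n, (Fin (n + 1) → K') → K'} (hβ : ∀ n v, f (β n v) = β' n (f ∘ v))
    {φ : TupleCochain K V (n + 1)} {ψ : TupleCochain K' W (n + 1)}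
    (h : ∀ v, g (φ v) = ψ (f ∘ v)) (v : Fin n → K) :
    g (sdHomotopy β n φ v) = sdHomotopy β' n ψ (f ∘ v) :=
  coneHomotopy_natural g f f (fun _ _ _ h => h) (fun _ _ _ h => sd_natural g f hβ h) hβ h v

/-! Locality: the operators at `v` only see tuples in sets which contain `v` and are closed
under taking barycentres. -/

theorem d_eq_zero {C : Set K} {φ : TupleCochain K V n} (h : ∀ w, (∀ i, w i ∈ C) → φ w = 0)
    (v : Fin (n + 1) → K) (hv : ∀ i, v i ∈ C) : d φ v = 0 := by
  rw [d_apply]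
  exact Finset.sum_eq_zero fun i _ => by rw [h (v ∘ i.succAbove) fun j => hv _, smul_zero]

theorem slice_eq_zero {C : Set K} {φ : TupleCochain K V (n + 1)}
    (h : ∀ w, (∀ i, w i ∈ C) → φ w = 0) (a : K) (ha : a ∈ C) (v : Fin n → K)
    (hv : ∀ i, v i ∈ C) : slice a φ v = 0 :=
  h _ (Fin.cases ha hv)

theorem sd_eq_zero {β : ∀ n, (Fin (n + 1) → K) → K} {C : Set K}
    (hβ : ∀ n v, (∀ i, v i ∈ C) → β n v ∈ C) {φ : TupleCochain K V n}
    (h : ∀ w, (∀ i, w i ∈ C) → φ w = 0) (v : Fin n → K) (hv : ∀ i, v i ∈ C) :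
    sd β n φ v = 0 := by
  induction n with
  | zero => exact h v hv
  | succ n ih =>
    exact d_eq_zero (fun w hw => ih (fun w hw => slice_eq_zero h _ (hβ n v hv) w hw) w hw) v hv

theorem sdHomotopy_eq_zero {β : ∀ n, (Fin (n + 1) → K) → K} {C : Set K}
    (hβ : ∀ n v, (∀ i, v i ∈ C) → β n v ∈ C) {φ : TupleCochain K V (n + 1)}
    (h : ∀ w, (∀ i, w i ∈ C) → φ w = 0) (v : Fin n → K) (hv : ∀ i, v i ∈ C) :
    sdHomotopy β n φ v = 0 := by
  induction n with
  | zero => rfl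
  | succ n ih =>
    have hs := fun w hw => slice_eq_zero h _ (hβ n v hv) w hw
    have h1 : d (sdHomotopy β n (slice (β n v) φ)) v = 0 :=
      d_eq_zero (fun w hw => ih hs w hw) v hv
    rw [sdHomotopy, coneHomotopy_succ_apply, sd_eq_zero hβ hs v hv, AddMonoidHom.id_apply,
      hs v hv, ← sdHomotopy, h1, sub_zero, sub_zero]

end TupleCochain

/-! ### Affine simplices in convex sets -/

section AffineSimplex

variable {E E' : Type*} [NormedAddCommGroup E] [NormedSpace ℝ E] [NormedAddCommGroup E']
  [NormedSpace ℝ E'] {K : Set E} {K' : Set E'}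

/-- The affine singular simplex with vertices `v` in a convex set. -/
def affineSimplex (hK : Convex ℝ K) {n : ℕ} (v : Fin (n + 1) → K) :
    C(stdSimplex ℝ (Fin (n + 1)), K) where
  toFun w := ⟨∑ i, w i • (v i : E), hK.sum_mem (fun i _ => w.2.1 i) w.2.2 fun i _ => (v i).2⟩
  continuous_toFun := by
    refine Continuous.subtype_mk (continuous_finsetSum _ fun i _ => ?_) _
    exact ((continuous_apply i).comp continuous_subtype_val).smul continuous_const

theorem affineSimplex_coe (hK : Convex ℝ K) {n : ℕ} (v : Fin (n + 1) → K)
    (w : stdSimplex ℝ (Fin (n + 1))) : (affineSimplex hK v w : E) = ∑ i, w i • (v i : E) := rfl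

theorem affineSimplex_mem (hK : Convex ℝ K) {C : Set E} (hC : Convex ℝ C) {n : ℕ}
    {v : Fin (n + 1) → K} (hv : ∀ i, (v i : E) ∈ C) (w : stdSimplex ℝ (Fin (n + 1))) :
    (affineSimplex hK v w : E) ∈ C :=
  hC.sum_mem (fun i _ => w.2.1 i) w.2.2 fun i _ => hv i

theorem affineSimplex_comp_simplexMap (hK : Convex ℝ K) {m n : ℕ} (v : Fin (n + 1) → K)
    (θ : SimplexCategory.mk m ⟶ SimplexCategory.mk n) :
    (affineSimplex hK v).comp (LocalSystem.simplexMap θ) = affineSimplex hK (v ∘ θ) := by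
  ext w
  change ∑ j, stdSimplex.map θ w j • (v j : E) = ∑ i, w i • (v (θ i) : E)
  simp only [stdSimplex.map_coe, FunOnFinite.linearMap_apply_apply, Finset.sum_smul]
  rw [← Finset.sum_fiberwise Finset.univ θ]
  refine Finset.sum_congr rfl fun j _ => Finset.sum_congr rfl fun i hi => ?_
  rw [(Finset.mem_filter.mp hi).2]

theorem affineSimplex_vertices (n : ℕ) :
    affineSimplex (convex_stdSimplex ℝ (Fin (n + 1))) (fun i => stdSimplex.vertex i) =
      ContinuousMap.id _ := by
  ext w j
  change (∑ i, w i • (Pi.single i 1 : Fin (n + 1) → ℝ)) j = w j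
  simp [Finset.sum_apply, Pi.single_apply]

/-- The map preserves convex combinations. -/
def PreservesConvex (hK : Convex ℝ K) (hK' : Convex ℝ K') (f : C(K, K')) : Prop :=
  ∀ (n : ℕ) (v : Fin (n + 1) → K), f.comp (affineSimplex hK v) = affineSimplex hK' (f ∘ v)

/-- The barycentre of a tuple of points of a convex set. -/
def bary (hK : Convex ℝ K) (n : ℕ) (v : Fin (n + 1) → K) : K :=
  affineSimplex hK v stdSimplex.barycenter

theorem PreservesConvex.map_bary {hK : Convex ℝ K} {hK' : Convex ℝ K'} {f : C(K, K')}
    (hf : PreservesConvex hK hK' f) (n : ℕ) (v : Fin (n + 1) → K) :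
    f (bary hK n v) = bary hK' n (f ∘ v) :=
  DFunLike.congr_fun (hf n v) _

theorem bary_mem (hK : Convex ℝ K) {C : Set E} (hC : Convex ℝ C) {n : ℕ}
    {v : Fin (n + 1) → K} (hv : ∀ i, (v i : E) ∈ C) : (bary hK n v : E) ∈ C :=
  affineSimplex_mem hK hC hv _

/-- The difference is the average of the `n + 1` vectors `v i - v k`, of which the one with `i = k`
is zero. -/
theorem dist_bary_le (hK : Convex ℝ K) {n : ℕ} {v : Fin (n + 1) → K} {r : ℝ}
    (hv : ∀ i j, dist (v i : E) (v j) ≤ r) (k : Fin (n + 1)) :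
    dist (bary hK n v : E) (v k) ≤ n / (n + 1) * r := by
  have h1 : (bary hK n v : E) - v k = ∑ i, (1 / (n + 1 : ℝ)) • ((v i : E) - v k) := by
    simp only [smul_sub, Finset.sum_sub_distrib, ← Finset.sum_smul]
    congr 1
    · rw [bary, affineSimplex_coe]
      refine Finset.sum_congr rfl fun i _ => ?_
      congr 1
      change ((Fintype.card (Fin (n + 1)) : ℝ))⁻¹ = _
      simp
    · simp [mul_inv_cancel₀ (show (n + 1 : ℝ) ≠ 0 by positivity)]
  rw [dist_eq_norm, h1]
  refine (norm_sum_le _ _).trans ?_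
  rw [← Finset.add_sum_erase _ _ (Finset.mem_univ k), sub_self, smul_zero, norm_zero, zero_add]
  refine (Finset.sum_le_card_nsmul _ _ (1 / (n + 1 : ℝ) * r) fun i _ => ?_).trans (le_of_eq ?_)
  · rw [norm_smul, Real.norm_of_nonneg (by positivity)]
    gcongr
    rw [← dist_eq_norm]
    exact hv i k
  · simp
    ring

theorem preservesConvex_simplexMap {m n : ℕ} (θ : SimplexCategory.mk m ⟶ SimplexCategory.mk n) :
    PreservesConvex (convex_stdSimplex ℝ (Fin (m + 1))) (convex_stdSimplex ℝ (Fin (n + 1)))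
      (LocalSystem.simplexMap θ) := by
  intro k v
  ext w j
  change FunOnFinite.linearMap ℝ ℝ θ (∑ i, w i • (v i : Fin (m + 1) → ℝ)) j =
    (∑ i, w i • FunOnFinite.linearMap ℝ ℝ θ (v i : Fin (m + 1) → ℝ)) j
  rw [map_sum]
  simp only [map_smul]

end AffineSimplex

/-! ### Iterated subdivisions are small -/

section Mesh

open TupleCochain

variable {E V : Type*} [NormedAddCommGroup E] [NormedSpace ℝ E] [AddCommGroup V] {K : Set E}

/-- One subdivision shrinks diameters by the factor `n / (n + 1)`: its simplices are cones from the
barycentre over the subdivided faces. The convex set `C` is there for the induction, to record that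
the pieces of a face stay near the barycentre of the whole simplex. -/
theorem sd_eq_zero_of_mesh (hK : Convex ℝ K) (n : ℕ) {C : Set E} (hC : Convex ℝ C) {r : ℝ}
    {φ : TupleCochain K V (n + 1)}
    (hφ : ∀ w : Fin (n + 1) → K, (∀ i, (w i : E) ∈ C) →
      (∀ i j, dist (w i : E) (w j) ≤ n / (n + 1) * r) → φ w = 0)
    (v : Fin (n + 1) → K) (hv : ∀ i, (v i : E) ∈ C) (hr : ∀ i j, dist (v i : E) (v j) ≤ r) :
    sd (bary hK) (n + 1) φ v = 0 := by
  have hr0 : 0 ≤ r := dist_nonneg.trans (hr 0 0)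
  induction n generalizing C with
  | zero =>
    rw [sd_succ_apply, d_apply]
    refine Finset.sum_eq_zero fun i _ => ?_
    change _ • φ (cons (bary hK 0 v) (v ∘ i.succAbove)) = 0
    rw [hφ, smul_zero]
    · exact Fin.cases (bary_mem hK hC hv) fun i => hv _
    · intro i j
      rw [Subsingleton.elim (α := Fin 1) i j, dist_self]
      simp
  | succ n ih =>
    rw [sd_succ_apply, d_apply]
    refine Finset.sum_eq_zero fun k _ => ?_
    have hb := dist_bary_le hK hr
    -- All vertices lie in this closed ball around the barycentre, and the ball is convex. Hence so
    -- do the pieces of each face, which bounds the edges leaving the apex.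
    rw [ih (C := C ∩ Metric.closedBall (bary hK (n + 1) v) ((n + 1 : ℕ) / ((n + 1 : ℕ) + 1) * r))
      (hC.inter (convex_closedBall _ _)) ?_ (v ∘ k.succAbove) ?_ fun i j => hr _ _, smul_zero]
    · intro w hw hd
      refine hφ _ (Fin.cases (bary_mem hK hC hv) fun i => (hw i).1) ?_
      have h1 : ∀ i, dist (bary hK (n + 1) v : E) (w i) ≤ (n + 1 : ℕ) / ((n + 1 : ℕ) + 1) * r :=
        fun i => by
          rw [dist_comm]
          exact (hw i).2
      have h2 : (n : ℝ) / (n + 1) * r ≤ (n + 1 : ℕ) / ((n + 1 : ℕ) + 1) * r := by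
        refine mul_le_mul_of_nonneg_right ?_ hr0
        rw [div_le_div_iff₀ (by positivity) (by positivity)]
        push_cast
        nlinarith
      refine Fin.cases (Fin.cases ?_ fun j => h1 j) fun i => Fin.cases ?_ fun j => ?_
      · rw [dist_self]
        positivity
      · rw [dist_comm]
        exact h1 i
      · exact (hd i j).trans h2
    · intro i
      refine ⟨hv _, ?_⟩
      rw [Metric.mem_closedBall, dist_comm]
      exact hb _

theorem sd_iterate_eq_zero_of_mesh (hK : Convex ℝ K) (n k : ℕ) {r : ℝ}
    {φ : TupleCochain K V (n + 1)}
    (hφ : ∀ w : Fin (n + 1) → K,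
      (∀ i j, dist (w i : E) (w j) ≤ (n / (n + 1) : ℝ) ^ k * r) → φ w = 0)
    (v : Fin (n + 1) → K) (hr : ∀ i j, dist (v i : E) (v j) ≤ r) :
    (sd (bary hK) (n + 1))^[k] φ v = 0 := by
  induction k generalizing r v with
  | zero => exact hφ v (by simpa using hr)
  | succ k ih =>
    rw [Function.iterate_succ_apply']
    refine sd_eq_zero_of_mesh hK n convex_univ (fun w _ hw => ih (fun w hw => hφ w ?_) w hw) v
      (fun _ => Set.mem_univ _) hr
    rwa [pow_succ, mul_assoc]

/-- If `φ` vanishes on tuples of small diameter, then its iterated subdivisions eventually vanish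
on any given tuple. -/
theorem exists_sd_iterate_eq_zero (hK : Convex ℝ K) (n : ℕ) {φ : TupleCochain K V (n + 1)}
    {δ : ℝ} (hδ : 0 < δ)
    (hφ : ∀ w : Fin (n + 1) → K, (∀ i j, dist (w i : E) (w j) < δ) → φ w = 0)
    (v : Fin (n + 1) → K) : ∃ N, ∀ k ≥ N, (sd (bary hK) (n + 1))^[k] φ v = 0 := by
  obtain ⟨r, hr⟩ : ∃ r, ∀ i j, dist (v i : E) (v j) ≤ r := by
    obtain ⟨r, hr⟩ := (Set.finite_range fun p : Fin (n + 1) × Fin (n + 1) =>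
      dist (v p.1 : E) (v p.2)).bddAbove
    exact ⟨r, fun i j => hr ⟨(i, j), rfl⟩⟩
  have hlim : Filter.Tendsto (fun k : ℕ => (n / (n + 1) : ℝ) ^ k * r) Filter.atTop (nhds 0) := by
    have h := tendsto_pow_atTop_nhds_zero_of_lt_one (r := (n / (n + 1) : ℝ)) (by positivity)
      ((div_lt_one (by positivity)).2 (lt_add_one _))
    simpa using h.mul_const r
  obtain ⟨N, hN⟩ := Filter.eventually_atTop.1 (hlim.eventually (gt_mem_nhds hδ))
  exact ⟨N, fun k hk => sd_iterate_eq_zero_of_mesh hK n k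
    (fun w hw => hφ w fun i j => (hw i j).trans_lt (hN k hk)) v hr⟩

end Mesh

/-! ### Evaluating cochains on affine simplices -/

namespace LocalSystem

open TupleCochain

variable {X : Type u} [TopologicalSpace X]

section Along

variable {K K' : Type*} [TopologicalSpace K] [SimplyConnectedSpace K] [TopologicalSpace K']
  [SimplyConnectedSpace K']

/-- Parallel transport `L_{κ(a)} → L_{κ(b)}` inside a singular simply connected space `κ`. -/
def along (L : LocalSystem X) (κ : C(K, X)) (a b : K) :
    L.obj (FundamentalGroupoid.mk (κ a)) →ₗ[ℂ] L.obj (FundamentalGroupoid.mk (κ b)) :=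
  (L.map ((FundamentalGroupoid.map κ).map
    (Path.Homotopic.Quotient.mk (PathConnectedSpace.somePath a b) :
      FundamentalGroupoid.mk a ⟶ FundamentalGroupoid.mk b))).hom

theorem along_eq (L : LocalSystem X) (κ : C(K, X)) (a b : K)
    (p : FundamentalGroupoid.mk a ⟶ FundamentalGroupoid.mk b) :
    L.along κ a b = (L.map ((FundamentalGroupoid.map κ).map p)).hom := by
  rw [along]
  congr 3
  exact Subsingleton.elim (α := Path.Homotopic.Quotient a b) _ _

theorem along_self (L : LocalSystem X) (κ : C(K, X)) (a : K) (x) : L.along κ a a x = x := by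
  have h : L.map ((FundamentalGroupoid.map κ).map (𝟙 (FundamentalGroupoid.mk a))) = 𝟙 _ :=
    ((FundamentalGroupoid.map κ ⋙ L).map_id _)
  rw [along_eq L κ a a (𝟙 _), h]
  rfl

theorem along_trans (L : LocalSystem X) (κ : C(K, X)) (a b c : K) (x) :
    L.along κ b c (L.along κ a b x) = L.along κ a c x := by
  rw [along_eq L κ a c (Path.Homotopic.Quotient.mk (PathConnectedSpace.somePath a b) ≫
    (Path.Homotopic.Quotient.mk (PathConnectedSpace.somePath b c) :
      FundamentalGroupoid.mk b ⟶ FundamentalGroupoid.mk c)), Functor.map_comp, Functor.map_comp]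
  rfl

theorem along_comp (L : LocalSystem X) (κ : C(K, X)) (f : C(K', K)) (a b : K') (x) :
    L.along (κ.comp f) a b x = L.along κ (f a) (f b) x := by
  rw [along_eq L κ (f a) (f b) ((FundamentalGroupoid.map f).map
    (Path.Homotopic.Quotient.mk (PathConnectedSpace.somePath a b) :
      FundamentalGroupoid.mk a ⟶ FundamentalGroupoid.mk b))]
  rfl

theorem transport_eq_along (L : LocalSystem X) {n : SimplexCategory} (σ : C(Simplex n, X))
    (a b : Simplex n) : L.transport σ a b = L.along σ a b := rfl

theorem along_congr (L : LocalSystem X) {m : SimplexCategory} (c : L.Cochain m)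
    (κ : C(K, X)) {e e' : C(Simplex m, K)} (h : e = e') (b : K) :
    L.along κ (e (initialVertex m)) b (c (κ.comp e)) =
      L.along κ (e' (initialVertex m)) b (c (κ.comp e')) := by
  subst h; rfl

end Along

/-- The coboundary of a singular cochain with coefficients in `L`. -/
def coboundary (L : LocalSystem X) (n : ℕ) :
    L.Cochain (SimplexCategory.mk n) →ₗ[ℂ] L.Cochain (SimplexCategory.mk (n + 1)) :=
  ∑ i : Fin (n + 2), (-1 : ℤ) ^ (i : ℕ) • L.cochainMap (SimplexCategory.δ i)

theorem coboundary_apply (L : LocalSystem X) (n : ℕ) (c : L.Cochain (SimplexCategory.mk n))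
    (σ : C(Simplex (SimplexCategory.mk (n + 1)), X)) :
    L.coboundary n c σ =
      ∑ i : Fin (n + 2), (-1 : ℤ) ^ (i : ℕ) • L.cochainMap (SimplexCategory.δ i) c σ := by
  simp [coboundary]

section EvalTuple

variable {E E' : Type*} [NormedAddCommGroup E] [NormedSpace ℝ E] [NormedAddCommGroup E']
  [NormedSpace ℝ E'] {K : Set E} {K' : Set E'} [SimplyConnectedSpace K] [SimplyConnectedSpace K']

/-- The tuple cochain obtained by evaluating a singular cochain on the images under `κ` of affine
simplices, and transporting the values to the point `b`. -/
def evalTuple (L : LocalSystem X) (hK : Convex ℝ K) (κ : C(K, X)) (b : K) {n : ℕ}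
    (c : L.Cochain (SimplexCategory.mk n)) :
    TupleCochain K (L.obj (FundamentalGroupoid.mk (κ b))) (n + 1) := fun v =>
  L.along κ (affineSimplex hK v (initialVertex (SimplexCategory.mk n))) b
    (c (κ.comp (affineSimplex hK v)))

theorem evalTuple_coboundary (L : LocalSystem X) (hK : Convex ℝ K) (κ : C(K, X)) (b : K) {n : ℕ}
    (c : L.Cochain (SimplexCategory.mk n)) :
    L.evalTuple hK κ b (L.coboundary n c) = d (L.evalTuple hK κ b c) := by
  ext v
  rw [evalTuple, coboundary_apply, map_sum, d_apply]
  refine Finset.sum_congr rfl fun i _ => ?_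
  rw [map_zsmul]
  congr 1
  rw [cochainMap_apply, transport_eq_along, along_comp, along_trans]
  exact L.along_congr c κ (affineSimplex_comp_simplexMap hK v (SimplexCategory.δ i)) b

/-- This supplies the hypothesis of the naturality lemmas above. Passing to a face changes both the
ambient convex set and the fibre to which values are transported, which is why those lemmas vary
points and coefficients together. -/
theorem evalTuple_comp (L : LocalSystem X) (hK : Convex ℝ K) (hK' : Convex ℝ K') (κ : C(K', X))
    {f : C(K, K')} (hf : PreservesConvex hK hK' f) (b : K) (b' : K') {n : ℕ}
    (c : L.Cochain (SimplexCategory.mk n)) (v : Fin (n + 1) → K) :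
    L.along κ (f b) b' (L.evalTuple hK (κ.comp f) b c v) = L.evalTuple hK' κ b' c (f ∘ v) := by
  rw [evalTuple, along_comp, along_trans]
  exact L.along_congr c κ (hf n v) b'

theorem evalTuple_eq_zero (L : LocalSystem X) (hK : Convex ℝ K) (κ : C(K, X)) (b : K) {n : ℕ}
    {c : L.Cochain (SimplexCategory.mk n)} {U : Set X} (hc : ∀ σ, (∀ x, σ x ∈ U) → c σ = 0)
    {C : Set E} (hC : Convex ℝ C) (hCU : ∀ x : K, (x : E) ∈ C → κ x ∈ U)
    (v : Fin (n + 1) → K) (hv : ∀ i, (v i : E) ∈ C) : L.evalTuple hK κ b c v = 0 := by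
  rw [evalTuple, hc _ fun x => hCU _ (affineSimplex_mem hK hC hv x), map_zero]

theorem evalTuple_vertices (L : LocalSystem X) {n : ℕ}
    (σ : C(Simplex (SimplexCategory.mk n), X)) (c : L.Cochain (SimplexCategory.mk n)) :
    L.evalTuple (convex_stdSimplex ℝ (Fin (n + 1))) σ (initialVertex (SimplexCategory.mk n)) c
      (fun i => stdSimplex.vertex i) = c σ :=
  (L.along_congr c σ (affineSimplex_vertices n) _).trans (L.along_self σ _ _)

end EvalTuple

/-- The cochain vanishes on all singular simplices contained in a member of `𝒰`. -/
def VanishesOn (L : LocalSystem X) {n : SimplexCategory} (𝒰 : Set (Set X)) (c : L.Cochain n) :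
    Prop :=
  ∀ U ∈ 𝒰, ∀ σ : C(Simplex n, X), (∀ x, σ x ∈ U) → c σ = 0

/-- A cocycle which vanishes on all the simplices that are small with respect to an open cover is
the coboundary of a cochain with the same property. -/
theorem exists_coboundary_eq_of_cover (L : LocalSystem X) {𝒰 : Set (Set X)}
    (ho : ∀ U ∈ 𝒰, IsOpen U) (hcov : ∀ x, ∃ U ∈ 𝒰, x ∈ U) {n : ℕ}
    {c : L.Cochain (SimplexCategory.mk (n + 1))} (hc : L.VanishesOn 𝒰 c)
    (hdc : L.coboundary (n + 1) c = 0) :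
    ∃ b : L.Cochain (SimplexCategory.mk n), L.VanishesOn 𝒰 b ∧ L.coboundary n b = c := by
  have hΔ := fun m : ℕ => convex_stdSimplex ℝ (Fin (m + 1))
  let φ := fun {m : ℕ} (σ : C(Simplex (SimplexCategory.mk m), X)) =>
    L.evalTuple (hΔ m) σ (initialVertex (SimplexCategory.mk m)) c
  let ι := fun (m : ℕ) (i : Fin (m + 1)) =>
    (stdSimplex.vertex i : Simplex (SimplexCategory.mk m))
  -- for each simplex, the cochain vanishes on tuples of small diameter
  have hsmall : ∀ {m : ℕ} (σ : C(Simplex (SimplexCategory.mk m), X)), ∃ δ > 0,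
      ∀ x : Simplex (SimplexCategory.mk m), ∀ v : Fin (n + 2) → Simplex (SimplexCategory.mk m),
      (∀ i, (v i : Fin (m + 1) → ℝ) ∈ Metric.ball (x : Fin (m + 1) → ℝ) δ) → φ σ v = 0 := by
    intro m σ
    -- A Lebesgue number for the cover pulled back along `σ`. Balls are convex, so an affine simplex
    -- with vertices in a small ball is mapped into a single member of the cover.
    obtain ⟨δ, hδ, h⟩ := lebesgue_number_lemma_of_metric_sUnion (s := Set.univ)
      (c := (fun U => σ ⁻¹' U) '' 𝒰) isCompact_univ
      (by
        rintro _ ⟨U, hU, rfl⟩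
        exact (ho U hU).preimage σ.continuous)
      (fun x _ => by
        obtain ⟨U, hU, hx⟩ := hcov (σ x)
        exact ⟨_, ⟨U, hU, rfl⟩, hx⟩)
    refine ⟨δ, hδ, fun x v hv => ?_⟩
    obtain ⟨_, ⟨U, hU, rfl⟩, hxU⟩ := h x (Set.mem_univ x)
    exact L.evalTuple_eq_zero (hΔ m) σ _ (hc U hU) (convex_ball (x : Fin (m + 1) → ℝ) δ)
      (fun y hy => hxU hy) v hv
  have hN : ∀ {m : ℕ} (σ : C(Simplex (SimplexCategory.mk m), X))
      (v : Fin (n + 1) → Simplex (SimplexCategory.mk m)), ∃ N, ∀ k ≥ N,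
      (sd (bary (hΔ m)) (n + 1))^[k] (sdHomotopy (bary (hΔ m)) (n + 1) (φ σ)) v = 0 := by
    intro m σ v
    obtain ⟨δ, hδ, h⟩ := hsmall σ
    refine exists_sd_iterate_eq_zero (hΔ m) n hδ (fun w hw => ?_) v
    exact sdHomotopy_eq_zero
      (C := Subtype.val ⁻¹' Metric.ball (w 0).1 δ)
      (fun n v hv => bary_mem (hΔ m) (convex_ball _ _) hv) (h (w 0)) w fun i => hw i 0
  have hN' : ∀ {m : ℕ} (σ : C(Simplex (SimplexCategory.mk m), X))
      (v : Fin (n + 2) → Simplex (SimplexCategory.mk m)), ∃ N, ∀ k ≥ N,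
      (sd (bary (hΔ m)) (n + 2))^[k] (φ σ) v = 0 := by
    intro m σ v
    obtain ⟨δ, hδ, h⟩ := hsmall σ
    exact exists_sd_iterate_eq_zero (hΔ m) (n + 1) hδ
      (fun w hw => h (w 0) w fun i => hw i 0) v
  choose N hN using fun σ : C(Simplex (SimplexCategory.mk n), X) => hN σ (ι n)
  -- Formally the primitive is the infinite sum `∑ sd^k T φ`, where `T` is the homotopy from the
  -- identity to `sd`. On each simplex only finitely many terms are nonzero, so the sum can be cut
  -- off at a bound depending on `σ`.
  refine ⟨fun σ => ∑ k ∈ Finset.range (N σ),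
    (sd (bary (hΔ n)) (n + 1))^[k] (sdHomotopy (bary (hΔ n)) (n + 1) (φ σ)) (ι n), ?_, ?_⟩
  · intro U hU σ hσ
    have h : φ σ = 0 := funext fun v => L.evalTuple_eq_zero (hΔ n) σ _ (hc U hU) convex_univ
      (fun x _ => hσ x) v fun _ => Set.mem_univ _
    simp only [h, map_zero, iterate_map_zero]
    exact Finset.sum_const_zero
  · ext σ
    obtain ⟨N', hN'⟩ := hN' σ (ι (n + 1))
    -- A cut-off valid for `σ` and for all its faces at once. Enlarging the cut-off of a face only
    -- adds vanishing terms.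
    let M := max N' (Finset.univ.sup fun j : Fin (n + 2) =>
      N (σ.comp (simplexMap (SimplexCategory.δ j))))
    have hface : ∀ j : Fin (n + 2),
        L.cochainMap (SimplexCategory.δ j) (fun σ => ∑ k ∈ Finset.range (N σ),
          (sd (bary (hΔ n)) (n + 1))^[k] (sdHomotopy (bary (hΔ n)) (n + 1) (φ σ)) (ι n)) σ =
        ∑ k ∈ Finset.range M, (sd (bary (hΔ (n + 1))) (n + 1))^[k]
          (sdHomotopy (bary (hΔ (n + 1))) (n + 1) (φ σ)) (ι (n + 1) ∘ j.succAbove) := by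
      intro j
      have hp := preservesConvex_simplexMap (SimplexCategory.δ j)
      have hι : simplexMap (SimplexCategory.δ j) ∘ ι n = ι (n + 1) ∘ j.succAbove :=
        funext fun i => stdSimplex.map_vertex _ _
      have hle : N (σ.comp (simplexMap (SimplexCategory.δ j))) ≤ M :=
        (Finset.le_sup (f := fun j : Fin (n + 2) =>
          N (σ.comp (simplexMap (SimplexCategory.δ j)))) (Finset.mem_univ j)).trans
          (le_max_right _ _)
      rw [cochainMap_apply, Finset.sum_subset (Finset.range_mono hle)
        fun k _ hk => hN _ k (by simpa using hk), map_sum]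
      refine Finset.sum_congr rfl fun k _ => ?_
      rw [← hι]
      exact sd_iterate_natural (LinearMap.toAddMonoidHom (L.transport σ _ _)) _
        (fun n v => hp.map_bary n v) (fun v => sdHomotopy_natural
          (LinearMap.toAddMonoidHom (L.transport σ _ _)) _ (fun n v => hp.map_bary n v)
          (fun v => L.evalTuple_comp (hΔ n) (hΔ (n + 1)) σ hp _ _ c v) v) k _
    have hφ : d (φ σ) = 0 := by
      change d (L.evalTuple _ _ _ c) = 0
      rw [← evalTuple_coboundary, hdc]
      ext v
      exact map_zero _
    have hT : d (sdHomotopy (bary (hΔ (n + 1))) (n + 1) (φ σ)) =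
        φ σ - sd (bary (hΔ (n + 1))) (n + 2) (φ σ) := by
      rw [← sdHomotopy_d, hφ, map_zero, zero_add]
    rw [coboundary_apply]
    simp only [hface, Finset.smul_sum]
    rw [Finset.sum_comm]
    -- Since `φ σ` is a cocycle, `d T φ = φ - sd φ`. The sum telescopes to `φ - sd^M φ`, and the
    -- last term vanishes on the vertices by the choice of `M`.
    simp only [← d_apply, ← sd_iterate_d, hT, iterate_map_sub, ← Function.iterate_succ_apply,
      Pi.sub_apply]
    rw [Finset.sum_range_sub', hN' M (le_max_left _ _), sub_zero]
    exact L.evalTuple_vertices σ c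

theorem VanishesOn.eq_zero_of_cover {L : LocalSystem X} {𝒰 : Set (Set X)}
    (hcov : ∀ x, ∃ U ∈ 𝒰, x ∈ U) {c : L.Cochain (SimplexCategory.mk 0)}
    (hc : L.VanishesOn 𝒰 c) : c = 0 := by
  ext σ
  obtain ⟨U, hU, hx⟩ := hcov (σ (initialVertex _))
  refine hc U hU σ fun x => ?_
  rwa [Subsingleton.elim (α := stdSimplex ℝ (Fin 1)) x (initialVertex (SimplexCategory.mk 0))]

end LocalSystem

/-! ### Prisms -/

section Prism

variable {m n : ℕ}

/-- The prism `Δⁿ × [0, 1]`. -/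
abbrev prism (n : ℕ) : Set ((Fin (n + 1) → ℝ) × ℝ) := stdSimplex ℝ (Fin (n + 1)) ×ˢ Set.Icc 0 1

theorem convex_prism (n : ℕ) : Convex ℝ (prism n) :=
  (convex_stdSimplex ℝ _).prod (convex_Icc 0 1)

instance (n : ℕ) : SimplyConnectedSpace (prism n) :=
  have : ContractibleSpace (prism n) := (convex_prism n).contractibleSpace
    ⟨(_, 0), single_mem_stdSimplex ℝ (0 : Fin (n + 1)), by simp⟩
  inferInstance

/-- The inclusion of `Δⁿ` into the prism at height `t`. -/
def prismSection (n : ℕ) (t : unitInterval) : C(stdSimplex ℝ (Fin (n + 1)), prism n) where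
  toFun x := ⟨(x.1, t), x.2, t.2⟩
  continuous_toFun := by fun_prop

/-- The map of prisms induced by a map of simplices. -/
def prismMap (θ : SimplexCategory.mk m ⟶ SimplexCategory.mk n) : C(prism m, prism n) where
  toFun p := ⟨((LocalSystem.simplexMap θ ⟨p.1.1, p.2.1⟩).1, p.1.2), Subtype.property _, p.2.2⟩
  continuous_toFun := by
    refine Continuous.subtype_mk (Continuous.prodMk (continuous_subtype_val.comp
      ((LocalSystem.simplexMap θ).continuous.comp ?_)) ?_) _
    · fun_prop
    · fun_prop

theorem preservesConvex_prismSection (n : ℕ) (t : unitInterval) :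
    PreservesConvex (convex_stdSimplex ℝ (Fin (n + 1))) (convex_prism n) (prismSection n t) := by
  intro k v
  ext1 w
  refine Subtype.ext (Prod.ext ?_ ?_)
  · change ∑ i, w i • (v i).1 = (∑ i, w i • (((v i).1, (t : ℝ)) : (Fin (n + 1) → ℝ) × ℝ)).1
    rw [Prod.fst_sum]
    rfl
  · change (t : ℝ) = (∑ i, w i • (((v i).1, (t : ℝ)) : (Fin (n + 1) → ℝ) × ℝ)).2
    rw [Prod.snd_sum]
    change _ = ∑ i, w i • (t : ℝ)
    rw [← Finset.sum_smul]
    exact ((congrArg (· • (t : ℝ)) w.2.2).trans (one_smul ℝ _)).symm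

theorem preservesConvex_prismMap (θ : SimplexCategory.mk m ⟶ SimplexCategory.mk n) :
    PreservesConvex (convex_prism m) (convex_prism n) (prismMap θ) := by
  intro k v
  ext1 w
  refine Subtype.ext (Prod.ext ?_ ?_)
  · change FunOnFinite.linearMap ℝ ℝ θ (∑ i, w i • (v i).1).1 =
      (∑ i, w i • ((FunOnFinite.linearMap ℝ ℝ θ (v i).1.1, (v i).1.2) :
        (Fin (n + 1) → ℝ) × ℝ)).1
    rw [Prod.fst_sum, Prod.fst_sum, map_sum]
    simp only [Prod.smul_fst, map_smul]
  · change (∑ i, w i • (v i).1).2 =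
      (∑ i, w i • ((FunOnFinite.linearMap ℝ ℝ θ (v i).1.1, (v i).1.2) :
        (Fin (n + 1) → ℝ) × ℝ)).2
    rw [Prod.snd_sum, Prod.snd_sum]
    rfl

end Prism

/-! ### Deformations and the vanishing of relative cohomology -/

namespace LocalSystem

open TupleCochain

variable {X : Type u} [TopologicalSpace X]

/-- The identification of the fibres over equal points. -/
def fiberCast (L : LocalSystem X) {x y : X} (h : x = y) :
    L.obj (FundamentalGroupoid.mk x) →ₗ[ℂ] L.obj (FundamentalGroupoid.mk y) :=
  (L.map (eqToHom (congrArg FundamentalGroupoid.mk h))).hom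

theorem fiberCast_rfl (L : LocalSystem X) {x : X} (h : x = x) (y) : L.fiberCast h y = y := by
  rw [fiberCast, eqToHom_refl, CategoryTheory.Functor.map_id]
  rfl

/-- The start of a homotopy equals the identity only pointwise, so the fibres at the bottom of the
prism and over the simplex must be identified by hand. Transport respects these identifications. -/
theorem along_fiberCast (L : LocalSystem X) {K K' : Type*} [TopologicalSpace K]
    [SimplyConnectedSpace K] [TopologicalSpace K'] [SimplyConnectedSpace K'] {κ : C(K', X)}
    {i : C(K, K')} {σ : C(K, X)} (h : ∀ a, κ (i a) = σ a) (a b : K) (x) :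
    L.along σ a b (L.fiberCast (h a) x) =
      L.fiberCast (h b) (L.along κ (i a) (i b) x) := by
  obtain rfl : κ.comp i = σ := ContinuousMap.ext h
  rw [fiberCast_rfl]
  refine (L.along_comp κ i a b x).trans (L.fiberCast_rfl _ _).symm

theorem fiberCast_evalTuple (L : LocalSystem X) {E E' : Type*} [NormedAddCommGroup E]
    [NormedSpace ℝ E] [NormedAddCommGroup E'] [NormedSpace ℝ E'] {K : Set E} {K' : Set E'}
    [SimplyConnectedSpace K] [SimplyConnectedSpace K'] (hK : Convex ℝ K) (hK' : Convex ℝ K')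
    {κ : C(K', X)} {i : C(K, K')} (hi : PreservesConvex hK hK' i) {σ : C(K, X)}
    (h : ∀ a, κ (i a) = σ a) (b : K) {n : ℕ} (c : L.Cochain (SimplexCategory.mk n))
    (v : Fin (n + 1) → K) :
    L.fiberCast (h b) (L.evalTuple hK' κ (i b) c (i ∘ v)) =
      L.evalTuple hK σ b c v := by
  obtain rfl : κ.comp i = σ := ContinuousMap.ext h
  refine (L.fiberCast_rfl _ _).trans ?_
  rw [← L.evalTuple_comp hK hK' κ hi b (i b) c v, along_self]

variable (h : C(X × unitInterval, X))

/-- The prism swept out by a singular simplex under a homotopy. -/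
def sweep {n : ℕ} (σ : C(Simplex (SimplexCategory.mk n), X)) : C(prism n, X) where
  toFun p := h (σ ⟨p.1.1, p.2.1⟩, ⟨p.1.2, p.2.2⟩)
  continuous_toFun := by
    refine h.continuous.comp (Continuous.prodMk (σ.continuous.comp ?_) ?_)
    · fun_prop
    · fun_prop

theorem sweep_prismSection (h0 : ∀ x, h (x, 0) = x) {n : ℕ}
    (σ : C(Simplex (SimplexCategory.mk n), X)) (a : Simplex (SimplexCategory.mk n)) :
    sweep h σ (prismSection n 0 a) = σ a :=
  h0 _

/-- The homotopy operator on tuple cochains of prisms. -/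
def prismHomotopy (V : Type*) [AddCommGroup V] (n m : ℕ) :
    TupleCochain (prism n) V (m + 1) →+ TupleCochain (stdSimplex ℝ (Fin (n + 1))) V m :=
  coneHomotopy (fun _ => comap (prismSection n 1)) (fun _ => comap (prismSection n 0))
    (fun _ v => prismSection n 0 (v 0)) m

theorem prismHomotopy_d (V : Type*) [AddCommGroup V] (n m : ℕ)
    (φ : TupleCochain (prism n) V (m + 1)) :
    prismHomotopy V n (m + 1) (d φ) + d (prismHomotopy V n m φ) =
      comap (prismSection n 1) φ - comap (prismSection n 0) φ := by
  refine coneHomotopy_d (fun _ => comap (prismSection n 1)) (fun _ => comap (prismSection n 0))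
    (fun _ _ => rfl) (fun _ _ => rfl) ?_ _ φ
  refine AddMonoidHom.ext fun φ => funext fun v => ?_
  exact congrArg φ (Subsingleton.elim _ _)

/-- The apex of each cone is the first vertex of the tuple, placed at the bottom of the prism, a
choice that commutes with maps of simplices. -/
theorem prismHomotopy_natural {V W : Type*} [AddCommGroup V] [AddCommGroup W] (g : V →+ W)
    {m n k : ℕ} (θ : SimplexCategory.mk m ⟶ SimplexCategory.mk n)
    {φ : TupleCochain (prism m) V (k + 1)} {ψ : TupleCochain (prism n) W (k + 1)}
    (hφ : ∀ v, g (φ v) = ψ (prismMap θ ∘ v)) (v : Fin k → stdSimplex ℝ (Fin (m + 1))) :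
    g (prismHomotopy V m k φ v) = prismHomotopy W n k ψ (simplexMap θ ∘ v) :=
  coneHomotopy_natural g (simplexMap θ) (prismMap θ) (fun _ _ _ hv _ => hv _)
    (fun _ _ _ hv _ => hv _) (fun _ _ => rfl) hφ v

section

variable (L : LocalSystem X) {P : Set X}

/-- The evaluation of a cochain on the triangulated prism over the tuple `v`, where the prism is
mapped to `X` by `κ`. -/
def evalPrism {m n : ℕ} (κ : C(prism m, X)) (c : L.Cochain (SimplexCategory.mk (n + 1)))
    (v : Fin (n + 1) → stdSimplex ℝ (Fin (m + 1))) :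
    L.obj (FundamentalGroupoid.mk (κ (prismSection m 0 (initialVertex (SimplexCategory.mk m))))) :=
  prismHomotopy _ m (n + 1) (L.evalTuple (convex_prism m) κ
    (prismSection m 0 (initialVertex (SimplexCategory.mk m))) c) v

theorem along_evalPrism {l m n : ℕ} (θ : SimplexCategory.mk l ⟶ SimplexCategory.mk m)
    (κ : C(prism m, X)) (c : L.Cochain (SimplexCategory.mk (n + 1)))
    (v : Fin (n + 1) → stdSimplex ℝ (Fin (l + 1))) :
    L.along κ (prismMap θ (prismSection l 0 (initialVertex (SimplexCategory.mk l))))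
      (prismSection m 0 (initialVertex (SimplexCategory.mk m)))
      (L.evalPrism (κ.comp (prismMap θ)) c v) = L.evalPrism κ c (simplexMap θ ∘ v) :=
  prismHomotopy_natural (LinearMap.toAddMonoidHom (L.along κ _ _))
    θ (fun v => L.evalTuple_comp (convex_prism l) (convex_prism m)
      κ (preservesConvex_prismMap θ) _ _ c v) _

/-- The cochain homotopy induced by a homotopy of maps, the first of which is the identity. -/
def deformationOperator (h0 : ∀ x, h (x, 0) = x) {n : ℕ}
    (c : L.Cochain (SimplexCategory.mk (n + 1))) : L.Cochain (SimplexCategory.mk n) := fun σ =>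
  L.fiberCast (sweep_prismSection h h0 σ (initialVertex _))
    (L.evalPrism (sweep h σ) c fun i => stdSimplex.vertex i)

theorem cochainMap_deformationOperator (h0 : ∀ x, h (x, 0) = x) {n : ℕ}
    (c : L.Cochain (SimplexCategory.mk (n + 1)))
    (σ : C(Simplex (SimplexCategory.mk (n + 1)), X)) (j : Fin (n + 2)) :
    L.cochainMap (SimplexCategory.δ j) (L.deformationOperator h h0 c) σ =
      L.fiberCast (sweep_prismSection h h0 σ (initialVertex _))
        (L.evalPrism (sweep h σ) c ((fun i => stdSimplex.vertex i) ∘ j.succAbove)) := by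
  have hι : simplexMap (SimplexCategory.δ j) ∘
      (fun i => (stdSimplex.vertex i : Simplex (SimplexCategory.mk n))) =
      (fun i => (stdSimplex.vertex i : Simplex (SimplexCategory.mk (n + 1)))) ∘ j.succAbove :=
    funext fun i => stdSimplex.map_vertex _ _
  rw [cochainMap_apply, transport_eq_along, ← hι, ← along_evalPrism]
  exact L.along_fiberCast (sweep_prismSection h h0 σ)
    (simplexMap (SimplexCategory.δ j) (initialVertex (SimplexCategory.mk n)))
    (initialVertex (SimplexCategory.mk (n + 1))) _

theorem evalTuple_sweep_top_eq_zero (h1 : ∀ x, h (x, 1) ∈ P) {m n : ℕ}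
    {c : L.Cochain (SimplexCategory.mk n)} (hc : L.VanishesOn {P} c)
    (σ : C(Simplex (SimplexCategory.mk m), X)) (b : prism m)
    (v : Fin (n + 1) → stdSimplex ℝ (Fin (m + 1))) :
    L.evalTuple (convex_prism m) (sweep h σ) b c (prismSection m 1 ∘ v) = 0 := by
  refine L.evalTuple_eq_zero (convex_prism m) _ b (hc P rfl) (C := {p | p.2 = 1})
    ?_ ?_ _ fun i => rfl
  · exact (convex_singleton (1 : ℝ)).linear_preimage (LinearMap.snd ℝ (Fin (m + 1) → ℝ) ℝ)
  · intro x hx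
    have h2 : (⟨x.1.2, x.2.2⟩ : unitInterval) = 1 := Subtype.ext hx
    change h (σ _, _) ∈ P
    rw [h2]
    exact h1 _

theorem evalTuple_coboundary_eq_zero {m n : ℕ} {c : L.Cochain (SimplexCategory.mk n)}
    (hdc : L.coboundary n c = 0) (κ : C(prism m, X)) (b : prism m) :
    d (L.evalTuple (convex_prism m) κ b c) = 0 := by
  rw [← evalTuple_coboundary, hdc]
  ext v
  exact map_zero _

/-- If a homotopy of self-maps of `X` deforms `X` into `P` and preserves `P`, then each cocycle of
the pair `(X, P)` is a coboundary. -/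
theorem exists_coboundary_eq_of_deformation (h0 : ∀ x, h (x, 0) = x) (h1 : ∀ x, h (x, 1) ∈ P)
    (hP : ∀ x ∈ P, ∀ t, h (x, t) ∈ P) {n : ℕ} {c : L.Cochain (SimplexCategory.mk (n + 1))}
    (hc : L.VanishesOn {P} c) (hdc : L.coboundary (n + 1) c = 0) :
    ∃ b : L.Cochain (SimplexCategory.mk n), L.VanishesOn {P} b ∧ L.coboundary n b = c := by
  -- The prism formula gives the top value minus the bottom value. The top lies in `P` and
  -- contributes zero, while the bottom contributes `c`, hence the sign.
  refine ⟨-L.deformationOperator h h0 c, ?_, ?_⟩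
  · rintro _ rfl σ hσ
    have h2 : L.evalTuple (convex_prism n) (sweep h σ)
        (prismSection n 0 (initialVertex (SimplexCategory.mk n))) c = 0 :=
      funext fun v => L.evalTuple_eq_zero (convex_prism n) _ _
        (hc _ rfl) convex_univ (fun x _ => hP _ (hσ _) _) v fun _ => Set.mem_univ _
    rw [Pi.neg_apply, deformationOperator, evalPrism, h2, map_zero, Pi.zero_apply, map_zero,
      neg_zero]
  · ext σ
    have hψ := congrFun (prismHomotopy_d _ (n + 1) (n + 1) (L.evalTuple (convex_prism (n + 1))
        (sweep h σ) (prismSection (n + 1) 0 (initialVertex (SimplexCategory.mk (n + 1)))) c))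
      (fun i => (stdSimplex.vertex i : Simplex (SimplexCategory.mk (n + 1))))
    rw [L.evalTuple_coboundary_eq_zero hdc, map_zero, zero_add, d_apply, Pi.sub_apply] at hψ
    have h2 := L.evalTuple_sweep_top_eq_zero h h1 hc σ
      (prismSection (n + 1) 0 (initialVertex (SimplexCategory.mk (n + 1))))
      (fun i => (stdSimplex.vertex i : Simplex (SimplexCategory.mk (n + 1))))
    rw [map_neg, Pi.neg_apply, coboundary_apply]
    simp only [cochainMap_deformationOperator, ← map_zsmul, ← map_sum, evalPrism]
    rw [hψ, ← map_neg, neg_sub]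
    refine (congrArg _ (congrArg (_ - ·) h2)).trans ?_
    rw [sub_zero]
    exact (L.fiberCast_evalTuple _ _ (preservesConvex_prismSection (n + 1) 0)
      (sweep_prismSection h h0 σ) _ c _).trans (L.evalTuple_vertices σ c)

/-- In the lowest degree the homotopy operator is zero, so the cocycle has the same value, up to
transport, at both ends of the track of a point. The final end lies in `P`. -/
theorem eq_zero_of_deformation (h0 : ∀ x, h (x, 0) = x) (h1 : ∀ x, h (x, 1) ∈ P)
    {c : L.Cochain (SimplexCategory.mk 0)} (hc : L.VanishesOn {P} c)
    (hdc : L.coboundary 0 c = 0) : c = 0 := by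
  ext σ
  have hψ := congrFun (prismHomotopy_d _ 0 0 (L.evalTuple (convex_prism 0) (sweep h σ)
    (prismSection 0 0 (initialVertex (SimplexCategory.mk 0))) c))
    (fun i => (stdSimplex.vertex i : Simplex (SimplexCategory.mk 0)))
  have h2 : prismHomotopy (L.obj (FundamentalGroupoid.mk (sweep h σ
    (prismSection 0 0 (initialVertex (SimplexCategory.mk 0)))))) 0 0 = 0 := rfl
  rw [L.evalTuple_coboundary_eq_zero hdc, map_zero, h2, AddMonoidHom.zero_apply, map_zero,
    add_zero, Pi.sub_apply] at hψ
  have h3 := (L.fiberCast_evalTuple (convex_stdSimplex ℝ _) _ (preservesConvex_prismSection 0 0)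
    (sweep_prismSection h h0 σ) (initialVertex (SimplexCategory.mk 0)) c
    (fun i => stdSimplex.vertex i)).trans (L.evalTuple_vertices σ c)
  have h4 := L.evalTuple_sweep_top_eq_zero h h1 hc σ
    (prismSection 0 0 (initialVertex (SimplexCategory.mk 0)))
    (fun i => (stdSimplex.vertex i : Simplex (SimplexCategory.mk 0)))
  rw [← h3]
  have h5 := sub_eq_zero.1 hψ.symm
  refine (congrArg _ (h5.symm.trans h4)).trans (map_zero _)

end

end LocalSystem

/-! ### Cosimplicial vector spaces and their cochain complexes -/

namespace CosimplicialModule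

open AlgebraicTopology

variable {Y Y₁ Y₂ Y₃ : CosimplicialObject (ModuleCat.{u} ℂ)}

/-- The cochain complex of a cosimplicial vector space. -/
abbrev complex (Y : CosimplicialObject (ModuleCat.{u} ℂ)) : CochainComplex (ModuleCat.{u} ℂ) ℕ :=
  (alternatingCofaceMapComplex (ModuleCat.{u} ℂ)).obj Y

/-- The morphism of cochain complexes induced by a morphism of cosimplicial vector spaces. -/
abbrev complexMap (f : Y₁ ⟶ Y₂) : complex Y₁ ⟶ complex Y₂ :=
  (alternatingCofaceMapComplex (ModuleCat.{u} ℂ)).map f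

/-- The differential as a linear map. -/
def diff (Y : CosimplicialObject (ModuleCat.{u} ℂ)) (n : ℕ) :
    Y.obj (SimplexCategory.mk n) →ₗ[ℂ] Y.obj (SimplexCategory.mk (n + 1)) :=
  (AlternatingCofaceMapComplex.objD Y n).hom

theorem diff_apply (Y : CosimplicialObject (ModuleCat.{u} ℂ)) (n : ℕ)
    (c : Y.obj (SimplexCategory.mk n)) :
    diff Y n c = ∑ i : Fin (n + 2), (-1 : ℤ) ^ (i : ℕ) • (Y.δ i).hom c := by
  simp [diff, ModuleCat.hom_sum]

theorem complex_d (Y : CosimplicialObject (ModuleCat.{u} ℂ)) (n : ℕ) :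
    (complex Y).d n (n + 1) = ModuleCat.ofHom (diff Y n) :=
  CochainComplex.of_d (fun n => Y.obj (SimplexCategory.mk n))
    (AlternatingCofaceMapComplex.objD Y) _

theorem map_diff (f : Y₁ ⟶ Y₂) (n : ℕ) (c : Y₁.obj (SimplexCategory.mk n)) :
    (f.app (SimplexCategory.mk (n + 1))).hom (diff Y₁ n c) =
      diff Y₂ n ((f.app (SimplexCategory.mk n)).hom c) := by
  rw [diff_apply, diff_apply, map_sum]
  refine Finset.sum_congr rfl fun i _ => ?_
  rw [map_zsmul]
  congr 1
  exact congrArg (fun g => g.hom c) (f.naturality (SimplexCategory.δ i))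

theorem exactAt_succ (n : ℕ)
    (h : ∀ c, diff Y (n + 1) c = 0 → ∃ b, diff Y n b = c) : (complex Y).ExactAt (n + 1) := by
  rw [HomologicalComplex.exactAt_iff' _ n (n + 1) (n + 2) (by simp) (by simp),
    ShortComplex.moduleCat_exact_iff]
  intro c hc
  change ((complex Y).d (n + 1) (n + 2)).hom c = 0 at hc
  change ∃ b, ((complex Y).d n (n + 1)).hom b = c
  rw [complex_d] at hc ⊢
  exact h c hc

theorem exactAt_zero (h : ∀ c, diff Y 0 c = 0 → c = 0) : (complex Y).ExactAt 0 := by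
  rw [HomologicalComplex.exactAt_iff' _ 0 0 1 (by simp) (by simp),
    ShortComplex.moduleCat_exact_iff]
  intro c hc
  change ((complex Y).d 0 1).hom c = 0 at hc
  rw [complex_d] at hc
  exact ⟨0, (map_zero _).trans (h c hc).symm⟩

theorem acyclic (h0 : ∀ c, diff Y 0 c = 0 → c = 0)
    (h : ∀ n c, diff Y (n + 1) c = 0 → ∃ b, diff Y n b = c) : (complex Y).Acyclic
  | 0 => exactAt_zero h0
  | n + 1 => exactAt_succ n (h n)

theorem diff_zero_injective (h : (complex Y).Acyclic) (c : Y.obj (SimplexCategory.mk 0))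
    (hc : diff Y 0 c = 0) : c = 0 := by
  have h0 := h 0
  rw [HomologicalComplex.exactAt_iff' _ 0 0 1 (by simp) (by simp),
    ShortComplex.moduleCat_exact_iff] at h0
  obtain ⟨b, hb⟩ := h0 c (by
    change ((complex Y).d 0 1).hom c = 0
    rwa [complex_d])
  change ((complex Y).d 0 0).hom b = c at hb
  rw [← hb, HomologicalComplex.shape _ _ _ (by simp)]
  rfl

theorem exists_diff_eq (h : (complex Y).Acyclic) {n : ℕ} (c : Y.obj (SimplexCategory.mk (n + 1)))
    (hc : diff Y (n + 1) c = 0) : ∃ b, diff Y n b = c := by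
  have h0 := h (n + 1)
  rw [HomologicalComplex.exactAt_iff' _ n (n + 1) (n + 2) (by simp) (by simp),
    ShortComplex.moduleCat_exact_iff] at h0
  obtain ⟨b, hb⟩ := h0 c (by
    change ((complex Y).d (n + 1) (n + 2)).hom c = 0
    rwa [complex_d])
  change ((complex Y).d n (n + 1)).hom b = c at hb
  rw [complex_d] at hb
  exact ⟨b, hb⟩

/-- The short complex of cochain complexes attached to an exact sequence of cosimplicial vector
spaces. -/
def shortComplex (f : Y₁ ⟶ Y₂) (g : Y₂ ⟶ Y₃)
    (hfg : ∀ n, Function.Exact (f.app n).hom (g.app n).hom) :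
    ShortComplex (CochainComplex (ModuleCat.{u} ℂ) ℕ) :=
  ShortComplex.mk (complexMap f) (complexMap g) (by
    ext n x
    exact (hfg _ _).2 ⟨x, rfl⟩)

theorem shortExact (f : Y₁ ⟶ Y₂) (g : Y₂ ⟶ Y₃)
    (hf : ∀ n, Function.Injective (f.app n).hom) (hg : ∀ n, Function.Surjective (g.app n).hom)
    (hfg : ∀ n, Function.Exact (f.app n).hom (g.app n).hom) :
    (shortComplex f g hfg).ShortExact := by
  refine HomologicalComplex.shortExact_of_degreewise_shortExact _ fun n => ?_
  have h1 : Mono (f.app (SimplexCategory.mk n)) := (ModuleCat.mono_iff_injective _).2 (hf _)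
  have h2 : Epi (g.app (SimplexCategory.mk n)) := (ModuleCat.epi_iff_surjective _).2 (hg _)
  exact
    { exact := (ShortComplex.moduleCat_exact_iff _).2 fun x hx => (hfg _ x).1 hx
      mono_f := h1
      epi_g := h2 }

/-- The product of two cosimplicial vector spaces. -/
def prod (Y₁ Y₂ : CosimplicialObject (ModuleCat.{u} ℂ)) :
    CosimplicialObject (ModuleCat.{u} ℂ) where
  obj n := ModuleCat.of ℂ (Y₁.obj n × Y₂.obj n)
  map θ := ModuleCat.ofHom ((Y₁.map θ).hom.prodMap (Y₂.map θ).hom)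
  map_id n := by
    ext1
    refine LinearMap.ext fun x => Prod.ext ?_ ?_
    · exact congrArg (fun f => f.hom x.1) (Y₁.map_id n)
    · exact congrArg (fun f => f.hom x.2) (Y₂.map_id n)
  map_comp θ η := by
    ext1
    refine LinearMap.ext fun x => Prod.ext ?_ ?_
    · exact congrArg (fun f => f.hom x.1) (Y₁.map_comp θ η)
    · exact congrArg (fun f => f.hom x.2) (Y₂.map_comp θ η)

/-- The first projection. -/
def fst (Y₁ Y₂ : CosimplicialObject (ModuleCat.{u} ℂ)) : prod Y₁ Y₂ ⟶ Y₁ where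
  app n := ModuleCat.ofHom (LinearMap.fst ℂ (Y₁.obj n) (Y₂.obj n))

/-- The second projection. -/
def snd (Y₁ Y₂ : CosimplicialObject (ModuleCat.{u} ℂ)) : prod Y₁ Y₂ ⟶ Y₂ where
  app n := ModuleCat.ofHom (LinearMap.snd ℂ (Y₁.obj n) (Y₂.obj n))

theorem diff_prod (n : ℕ) (c : (prod Y₁ Y₂).obj (SimplexCategory.mk n)) :
    diff (prod Y₁ Y₂) n c = (diff Y₁ n c.1, diff Y₂ n c.2) :=
  Prod.ext (map_diff (fst Y₁ Y₂) n c) (map_diff (snd Y₁ Y₂) n c)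

theorem prod_acyclic (h₁ : (complex Y₁).Acyclic) (h₂ : (complex Y₂).Acyclic) :
    (complex (prod Y₁ Y₂)).Acyclic := by
  refine acyclic (fun c hc => ?_) (fun n c hc => ?_)
  · rw [diff_prod] at hc
    exact Prod.ext (diff_zero_injective h₁ _ (congrArg Prod.fst hc))
      (diff_zero_injective h₂ _ (congrArg Prod.snd hc))
  · rw [diff_prod] at hc
    obtain ⟨b₁, hb₁⟩ := exists_diff_eq h₁ _ (congrArg Prod.fst hc)
    obtain ⟨b₂, hb₂⟩ := exists_diff_eq h₂ _ (congrArg Prod.snd hc)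
    exact ⟨(b₁, b₂), (diff_prod n _).trans (Prod.ext hb₁ hb₂)⟩

end CosimplicialModule

/-! ### Relative cochains -/

namespace LocalSystem

open CosimplicialModule

variable {X Y : Type u} [TopologicalSpace X] [TopologicalSpace Y]

/-- The cochains which vanish on the simplices contained in a member of `𝒰`. -/
def relSubmodule (L : LocalSystem X) (𝒰 : Set (Set X)) (n : SimplexCategory) :
    Submodule ℂ (L.Cochain n) where
  carrier := {c | L.VanishesOn 𝒰 c}
  zero_mem' _ _ _ _ := rfl
  add_mem' ha hb U hU σ hσ := by rw [Pi.add_apply, ha U hU σ hσ, hb U hU σ hσ, add_zero]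
  smul_mem' r _ ha U hU σ hσ := by rw [Pi.smul_apply, ha U hU σ hσ, smul_zero]

/-- The cosimplicial vector space of relative cochains. -/
def relCochains (L : LocalSystem X) (𝒰 : Set (Set X)) :
    CosimplicialObject (ModuleCat.{u} ℂ) where
  obj n := ModuleCat.of ℂ (L.relSubmodule 𝒰 n)
  map {m n} θ := ModuleCat.ofHom ((L.cochainMap θ).restrict fun c hc U hU σ hσ => by
    rw [cochainMap_apply, hc U hU _ fun x => hσ _, map_zero])
  map_id n := by
    ext1
    refine LinearMap.ext fun c => Subtype.ext ?_
    exact congrArg (fun f => f.hom c.1) (L.cosimplicialCochains.map_id n)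
  map_comp θ η := by
    ext1
    refine LinearMap.ext fun c => Subtype.ext ?_
    exact congrArg (fun f => f.hom c.1) (L.cosimplicialCochains.map_comp θ η)

/-- The complex of relative cochains. -/
abbrev relComplex (L : LocalSystem X) (𝒰 : Set (Set X)) : CochainComplex (ModuleCat.{u} ℂ) ℕ :=
  complex (L.relCochains 𝒰)

/-- The inclusion of the relative cochains into all the cochains. -/
def relInclusion (L : LocalSystem X) (𝒰 : Set (Set X)) :
    L.relCochains 𝒰 ⟶ L.cosimplicialCochains where
  app n := ModuleCat.ofHom (L.relSubmodule 𝒰 n).subtype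

theorem coe_diff_relCochains (L : LocalSystem X) (𝒰 : Set (Set X)) (n : ℕ)
    (c : L.relSubmodule 𝒰 (SimplexCategory.mk n)) :
    (diff (L.relCochains 𝒰) n c : L.relSubmodule 𝒰 _).1 = L.coboundary n c.1 := by
  refine (map_diff (L.relInclusion 𝒰) n c).trans ?_
  rw [diff_apply, coboundary, LinearMap.sum_apply]
  rfl

theorem relComplex_acyclic (L : LocalSystem X) {𝒰 : Set (Set X)}
    (h0 : ∀ c : L.Cochain (SimplexCategory.mk 0), L.VanishesOn 𝒰 c → L.coboundary 0 c = 0 → c = 0)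
    (h : ∀ n (c : L.Cochain (SimplexCategory.mk (n + 1))), L.VanishesOn 𝒰 c →
      L.coboundary (n + 1) c = 0 →
      ∃ b : L.Cochain (SimplexCategory.mk n), L.VanishesOn 𝒰 b ∧ L.coboundary n b = c) :
    (L.relComplex 𝒰).Acyclic := by
  refine acyclic (fun (c : L.relSubmodule 𝒰 _) hc => ?_)
    (fun n (c : L.relSubmodule 𝒰 _) hc => ?_)
  · refine Subtype.ext (h0 c.1 c.2 ?_)
    rw [← coe_diff_relCochains, hc]
    rfl
  · obtain ⟨b, hb, hbc⟩ := h n c.1 c.2 (by rw [← coe_diff_relCochains, hc]; rfl)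
    exact ⟨(⟨b, hb⟩ : L.relSubmodule 𝒰 _), Subtype.ext ((coe_diff_relCochains ..).trans hbc)⟩

theorem relComplex_acyclic_of_cover (L : LocalSystem X) {𝒰 : Set (Set X)}
    (ho : ∀ U ∈ 𝒰, IsOpen U) (hcov : ∀ x, ∃ U ∈ 𝒰, x ∈ U) : (L.relComplex 𝒰).Acyclic :=
  L.relComplex_acyclic (fun _ hc _ => hc.eq_zero_of_cover hcov)
    fun _ _ hc hdc => L.exists_coboundary_eq_of_cover ho hcov hc hdc

theorem relComplex_acyclic_of_deformation (L : LocalSystem X) {P : Set X}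
    (h : C(X × unitInterval, X)) (h0 : ∀ x, h (x, 0) = x) (h1 : ∀ x, h (x, 1) ∈ P)
    (hP : ∀ x ∈ P, ∀ t, h (x, t) ∈ P) : (L.relComplex {P}).Acyclic :=
  L.relComplex_acyclic (fun _ hc hdc => L.eq_zero_of_deformation h h0 h1 hc hdc)
    fun _ _ hc hdc => L.exists_coboundary_eq_of_deformation h h0 h1 hP hc hdc

/-- The inclusion between spaces of relative cochains. -/
def relMono (L : LocalSystem X) {𝒰 𝒱 : Set (Set X)} (h : ∀ V ∈ 𝒱, ∃ U ∈ 𝒰, V ⊆ U) :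
    L.relCochains 𝒰 ⟶ L.relCochains 𝒱 where
  app n := ModuleCat.ofHom (Submodule.inclusion fun c hc V hV σ hσ => by
    obtain ⟨U, hU, hVU⟩ := h V hV
    exact hc U hU σ fun x => hVU (hσ x))

/-- The restriction of relative cochains along a continuous map. -/
def relPullback (L : LocalSystem X) (f : C(Y, X)) {𝒰 : Set (Set X)} {𝒱 : Set (Set Y)}
    (h : ∀ V ∈ 𝒱, ∃ U ∈ 𝒰, V ⊆ f ⁻¹' U) :
    L.relCochains 𝒰 ⟶ (L.pullback f).relCochains 𝒱 where
  app n := ModuleCat.ofHom (LinearMap.restrict ((cochainPullback f L).app n).hom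
    fun c hc V hV σ hσ => by
      obtain ⟨U, hU, hVU⟩ := h V hV
      exact hc U hU (f.comp σ) fun x => hVU (hσ x))
  naturality _ _ _ := rfl

/-- Extension by zero. Injectivity of `f` makes the factorization of a simplex through `f` unique,
so the chosen factor does not matter. -/
theorem exists_extension (L : LocalSystem X) {f : C(Y, X)} (hf : Function.Injective f)
    {n : SimplexCategory} (c : (L.pullback f).Cochain n) :
    ∃ C : L.Cochain n, (∀ τ : C(Simplex n, Y), C (f.comp τ) = c τ) ∧
      ∀ σ, (¬ ∃ τ : C(Simplex n, Y), f.comp τ = σ) → C σ = 0 := by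
  classical
  refine ⟨fun σ => if h : ∃ τ : C(Simplex n, Y), f.comp τ = σ then
    L.fiberCast (DFunLike.congr_fun h.choose_spec _) (c h.choose) else 0, fun τ => ?_,
    fun σ hσ => dif_neg hσ⟩
  have h : ∃ τ' : C(Simplex n, Y), f.comp τ' = f.comp τ := ⟨τ, rfl⟩
  have key : ∀ τ' (h' : f.comp τ' = f.comp τ),
      L.fiberCast (DFunLike.congr_fun h' (initialVertex n)) (c τ') = c τ := by
    intro τ' h'
    obtain rfl : τ' = τ := ContinuousMap.ext fun x => hf (DFunLike.congr_fun h' x)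
    exact L.fiberCast_rfl _ _
  exact (dif_pos h).trans (key _ h.choose_spec)

theorem exists_comp_eq {f : C(Y, X)} (hf : Topology.IsEmbedding f) {n : SimplexCategory}
    {σ : C(Simplex n, X)} (hσ : ∀ x, σ x ∈ Set.range f) : ∃ τ : C(Simplex n, Y), f.comp τ = σ := by
  choose τ hτ using hσ
  refine ⟨⟨τ, hf.continuous_iff.2 ?_⟩, ContinuousMap.ext hτ⟩
  rw [show f ∘ τ = σ from funext hτ]
  exact σ.continuous

/-- The cochains on a subspace as the quotient of the cochains by the relative cochains. -/
theorem pullback_shortExact (L : LocalSystem X) {f : C(Y, X)} (hf : Topology.IsEmbedding f) :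
    ∃ h, (shortComplex (L.relInclusion {Set.range f}) (cochainPullback f L) h).ShortExact := by
  refine ⟨fun n => ?_, shortExact _ _ (fun n => ?_) (fun n c => ?_) _⟩
  · intro c
    refine ⟨fun hc => ?_, ?_⟩
    · refine ⟨(⟨c, ?_⟩ : L.relSubmodule _ n), rfl⟩
      rintro _ rfl σ hσ
      obtain ⟨τ, rfl⟩ := exists_comp_eq hf hσ
      exact congrFun hc τ
    · rintro ⟨c, rfl⟩
      exact funext fun τ => (c : L.relSubmodule _ n).2 _ rfl (f.comp τ) fun x => ⟨τ x, rfl⟩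
  · exact Subtype.val_injective
  · obtain ⟨C, hC, -⟩ := L.exists_extension hf.injective c
    exact ⟨C, funext hC⟩

/-- The relative version of `pullback_shortExact`. -/
theorem relPullback_shortExact (L : LocalSystem X) {f : C(Y, X)} (hf : Topology.IsEmbedding f)
    {𝒲 𝒰 : Set (Set X)} {𝒱 : Set (Set Y)} (h𝒲 : ∀ U ∈ 𝒰, ∃ W ∈ 𝒲, U ⊆ W)
    (hr : ∃ W ∈ 𝒲, Set.range f ⊆ W) (h𝒲' : ∀ W ∈ 𝒲, (∃ U ∈ 𝒰, W ⊆ U) ∨ W ⊆ Set.range f)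
    (h𝒱 : ∀ V ∈ 𝒱, ∃ U ∈ 𝒰, V ⊆ f ⁻¹' U) (h𝒱' : ∀ U ∈ 𝒰, ∃ V ∈ 𝒱, f ⁻¹' U ⊆ V) :
    ∃ h, (shortComplex (L.relMono h𝒲) (L.relPullback f h𝒱) h).ShortExact := by
  refine ⟨fun n => ?_, shortExact _ _ (fun n => ?_)
    (fun n c => ?_) _⟩
  -- The conditions on `𝒲` make vanishing on it the same as vanishing on `𝒰` and restricting to zero
  -- along `f`.
  · intro (c : L.relSubmodule 𝒰 n)
    refine ⟨fun hc => ?_, ?_⟩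
    · refine ⟨(⟨c.1, fun W hW σ hσ => ?_⟩ : L.relSubmodule 𝒲 n), rfl⟩
      obtain ⟨U, hU, hWU⟩ | hWr := h𝒲' W hW
      · exact c.2 U hU σ fun x => hWU (hσ x)
      · obtain ⟨τ, rfl⟩ := exists_comp_eq hf fun x => hWr (hσ x)
        exact congrFun (congrArg Subtype.val hc) τ
    · rintro ⟨c, rfl⟩
      obtain ⟨W, hW, hrW⟩ := hr
      exact Subtype.ext (funext fun τ =>
        (c : L.relSubmodule 𝒲 n).2 W hW (f.comp τ) fun x => hrW ⟨τ x, rfl⟩)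
  · intro a b hab
    exact Subtype.ext (congrArg (fun c : L.relSubmodule 𝒰 n => c.1) hab)
  · obtain ⟨C, hC, hC0⟩ := L.exists_extension hf.injective (c : (L.pullback f).relSubmodule 𝒱 n).1
    refine ⟨(⟨C, fun U hU σ hσ => ?_⟩ : L.relSubmodule 𝒰 n), Subtype.ext (funext hC)⟩
    by_cases h : ∃ τ : C(Simplex n, Y), f.comp τ = σ
    · obtain ⟨τ, rfl⟩ := h
      obtain ⟨V, hV, hUV⟩ := h𝒱' U hU
      rw [hC]
      exact (c : (L.pullback f).relSubmodule 𝒱 n).2 V hV τ fun x => hUV (hσ x)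
    · exact hC0 σ h

/-- The diagonal inclusion of the cochains vanishing on `P` and on `Q`. -/
def relDiagonal (L : LocalSystem X) (P Q : Set X) :
    L.relCochains {P, Q} ⟶ prod (L.relCochains {P}) (L.relCochains {Q}) where
  app n := ModuleCat.ofHom (LinearMap.prod
    (Submodule.inclusion fun _ hc _ hU => hc _ (Or.inl hU))
    (Submodule.inclusion fun _ hc _ hU => hc _ (Or.inr hU)))

theorem relSubmodule_inter_le_left (L : LocalSystem X) (P Q : Set X) (n : SimplexCategory) :
    L.relSubmodule {P} n ≤ L.relSubmodule {P ∩ Q} n := by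
  rintro c hc _ rfl σ hσ
  exact hc P rfl σ fun x => (hσ x).1

theorem relSubmodule_inter_le_right (L : LocalSystem X) (P Q : Set X) (n : SimplexCategory) :
    L.relSubmodule {Q} n ≤ L.relSubmodule {P ∩ Q} n := by
  rintro c hc _ rfl σ hσ
  exact hc Q rfl σ fun x => (hσ x).2

/-- The difference of a cochain vanishing on `P` and a cochain vanishing on `Q`. -/
def relDifference (L : LocalSystem X) (P Q : Set X) :
    prod (L.relCochains {P}) (L.relCochains {Q}) ⟶ L.relCochains {P ∩ Q} where
  app n := ModuleCat.ofHom (LinearMap.coprod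
    (Submodule.inclusion (L.relSubmodule_inter_le_left P Q n))
    (-Submodule.inclusion (L.relSubmodule_inter_le_right P Q n)))
  naturality m n θ := by
    ext1
    refine LinearMap.ext fun c => ?_
    refine Subtype.ext ?_
    change L.cochainMap θ _ + -L.cochainMap θ _ = L.cochainMap θ (_ + -_)
    rw [map_add, map_neg]
    rfl

theorem mayerVietoris_shortExact (L : LocalSystem X) (P Q : Set X) :
    ∃ h, (shortComplex (L.relDiagonal P Q) (L.relDifference P Q) h).ShortExact := by
  classical
  refine ⟨fun n => ?_, shortExact _ _ (fun n => ?_)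
    (fun n c' => ?_) _⟩
  · intro (c : L.relSubmodule {P} n × L.relSubmodule {Q} n)
    refine ⟨fun hc => ?_, ?_⟩
    · have h : c.1.1 = c.2.1 := by
        have h := congrArg Subtype.val hc
        change c.1.1 + -c.2.1 = 0 at h
        rwa [← sub_eq_add_neg, sub_eq_zero] at h
      refine ⟨(⟨c.1.1, ?_⟩ : L.relSubmodule {P, Q} n), Prod.ext rfl (Subtype.ext h)⟩
      rintro _ (rfl | rfl)
      · exact c.1.2 _ rfl
      · rw [h]
        exact c.2.2 _ rfl
    · rintro ⟨c, rfl⟩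
      exact Subtype.ext (add_neg_cancel _)
  · intro a b hab
    exact Subtype.ext (congrArg (fun c : L.relSubmodule {P} n × L.relSubmodule {Q} n => c.1.1) hab)
  · let c : L.relSubmodule {P ∩ Q} n := c'
    -- Splitting `c` as `a - (a - c)`: the second part is supported on simplices inside `P`, and `c`
    -- itself vanishes on those that also lie in `Q`.
    let a : L.Cochain n := fun σ => if ∀ x, σ x ∈ P then 0 else c.1 σ
    refine ⟨((⟨a, ?_⟩, ⟨a - c.1, ?_⟩) : L.relSubmodule {P} n × L.relSubmodule {Q} n),
      Subtype.ext ?_⟩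
    · rintro _ rfl σ hσ
      exact if_pos hσ
    · rintro _ rfl σ hσ
      rw [Pi.sub_apply, sub_eq_zero]
      by_cases h : ∀ x, σ x ∈ P
      · rw [c.2 _ rfl σ fun x => ⟨h x, hσ x⟩]
        exact if_pos h
      · exact if_neg h
    · change a + -(a - c.1) = c.1
      abel

theorem isIso_relInclusion_empty (L : LocalSystem X) : IsIso (L.relInclusion {∅}) := by
  have : ∀ n, IsIso ((L.relInclusion {∅}).app n) := fun n => by
    refine (ConcreteCategory.isIso_iff_bijective _).2 ⟨Subtype.val_injective, fun c => ?_⟩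
    refine ⟨(⟨c, ?_⟩ : L.relSubmodule {∅} n), rfl⟩
    rintro _ rfl σ hσ
    exact (hσ (initialVertex n)).elim
  exact NatIso.isIso_of_isIso_app _

end LocalSystem

/-! ### The relative cohomology of a trivial line bundle -/

section ShortExact

variable {S : ShortComplex (CochainComplex (ModuleCat.{u} ℂ) ℕ)}

theorem homology_iso_of_acyclic_left (hS : S.ShortExact) (h : S.X₁.Acyclic) (n : ℕ) :
    Nonempty (S.X₂.homology n ≅ S.X₃.homology n) := by
  have h1 : Mono (HomologicalComplex.homologyMap S.g n) :=
    (hS.homology_exact₂ n).mono_g ((h n).isZero_homology.eq_of_src _ _)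
  have h2 : Epi (HomologicalComplex.homologyMap S.g n) :=
    (hS.homology_exact₃ n (n + 1) rfl).epi_f ((h (n + 1)).isZero_homology.eq_of_tgt _ _)
  have := isIso_of_mono_of_epi (HomologicalComplex.homologyMap S.g n)
  exact ⟨asIso (HomologicalComplex.homologyMap S.g n)⟩

theorem homology_iso_of_acyclic_mid (hS : S.ShortExact) (h : S.X₂.Acyclic) (n : ℕ) :
    Nonempty (S.X₃.homology n ≅ S.X₁.homology (n + 1)) :=
  ⟨hS.δIso n (n + 1) rfl (h n).isZero_homology (h (n + 1)).isZero_homology⟩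

/-- Injectivity follows from the preceding term of the long exact sequence. There is none in degree
0, hence the extra hypothesis. -/
theorem homology_iso_of_acyclic_right (hS : S.ShortExact) (h : S.X₃.Acyclic) (n : ℕ)
    (hf : Mono (HomologicalComplex.homologyMap S.f 0)) :
    Nonempty (S.X₁.homology n ≅ S.X₂.homology n) := by
  have h1 : Epi (HomologicalComplex.homologyMap S.f n) :=
    (hS.homology_exact₂ n).epi_f ((h n).isZero_homology.eq_of_tgt _ _)
  have h2 : Mono (HomologicalComplex.homologyMap S.f n) := by
    cases n with
    | zero => exact hf
    | succ n =>
      exact (hS.homology_exact₁ n (n + 1) rfl).mono_g ((h n).isZero_homology.eq_of_src _ _)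
  have := isIso_of_mono_of_epi (HomologicalComplex.homologyMap S.f n)
  exact ⟨asIso (HomologicalComplex.homologyMap S.f n)⟩

end ShortExact

namespace CosimplicialModule

theorem mono_homologyMap_zero {Y₁ Y₂ : CosimplicialObject (ModuleCat.{u} ℂ)} (f : Y₁ ⟶ Y₂)
    (hf : ∀ n, Function.Injective (f.app n).hom) :
    Mono (HomologicalComplex.homologyMap (complexMap f) 0) := by
  have h : Mono ((complexMap f).f 0) := (ModuleCat.mono_iff_injective _).2 (hf _)
  have hπ : ∀ Y : CosimplicialObject (ModuleCat.{u} ℂ), IsIso ((complex Y).homologyπ 0) :=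
    fun Y => (complex Y).isIso_homologyπ 0 0 (by simp) (by
      rw [HomologicalComplex.shape _ _ _ (by simp)])
  have h2 : Mono (HomologicalComplex.cyclesMap (complexMap f) 0) := by
    have : Mono (HomologicalComplex.cyclesMap (complexMap f) 0 ≫ (complex Y₂).iCycles 0) := by
      rw [HomologicalComplex.cyclesMap_i]
      infer_instance
    exact mono_of_mono _ ((complex Y₂).iCycles 0)
  have h3 := hπ Y₁
  have h4 : Mono ((complex Y₁).homologyπ 0 ≫
      HomologicalComplex.homologyMap (complexMap f) 0) := by
    rw [HomologicalComplex.homologyπ_naturality]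
    have := hπ Y₂
    infer_instance
  rw [← IsIso.inv_hom_id_assoc ((complex Y₁).homologyπ 0)
    (HomologicalComplex.homologyMap (complexMap f) 0)]
  infer_instance

end CosimplicialModule

namespace LocalSystem

open CosimplicialModule

variable {X : Type u} [TopologicalSpace X]

/-- The quotient of the two complexes consists of the cochains on `P ∪ Q` vanishing on `P` and on
`Q`, which is acyclic because these sets form an open cover of the union. -/
theorem relComplex_union_iso (L : LocalSystem X) {P Q : Set X} (hP : IsOpen P) (hQ : IsOpen Q)
    (n : ℕ) :
    Nonempty ((L.relComplex {P ∪ Q}).homology n ≅ (L.relComplex {P, Q}).homology n) := by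
  let f : C(↥(P ∪ Q), X) := ⟨Subtype.val, continuous_subtype_val⟩
  have hr : Set.range f = P ∪ Q := Subtype.range_coe
  obtain ⟨h, hS⟩ := L.relPullback_shortExact (f := f) Topology.IsEmbedding.subtypeVal
    (𝒲 := {P ∪ Q}) (𝒰 := {P, Q}) (𝒱 := {f ⁻¹' P, f ⁻¹' Q})
    (by
      rintro _ (rfl | rfl)
      · exact ⟨_, rfl, Set.subset_union_left⟩
      · exact ⟨_, rfl, Set.subset_union_right⟩)
    ⟨_, rfl, hr.le⟩
    (by
      rintro _ rfl
      exact Or.inr hr.ge)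
    (by
      rintro _ (rfl | rfl)
      · exact ⟨P, Or.inl rfl, le_rfl⟩
      · exact ⟨Q, Or.inr rfl, le_rfl⟩)
    (by
      rintro _ (rfl | rfl)
      · exact ⟨_, Or.inl rfl, le_rfl⟩
      · exact ⟨_, Or.inr rfl, le_rfl⟩)
  refine homology_iso_of_acyclic_right hS ?_ n (mono_homologyMap_zero _ fun m a b hab => ?_)
  · refine (L.pullback f).relComplex_acyclic_of_cover ?_ ?_
    · rintro _ (rfl | rfl)
      · exact hP.preimage f.continuous
      · exact hQ.preimage f.continuous
    · rintro ⟨x, hx | hx⟩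
      · exact ⟨_, Or.inl rfl, hx⟩
      · exact ⟨_, Or.inr rfl, hx⟩
  · exact Subtype.ext (congrArg (fun c : L.relSubmodule {P, Q} m => c.1) hab)

theorem relComplex_union_iso_inter (L : LocalSystem X) {P Q : Set X} (hP : IsOpen P)
    (hQ : IsOpen Q) (hLP : (L.relComplex {P}).Acyclic) (hLQ : (L.relComplex {Q}).Acyclic) (n : ℕ) :
    Nonempty ((L.relComplex {P ∪ Q}).homology (n + 1) ≅ (L.relComplex {P ∩ Q}).homology n) := by
  obtain ⟨e⟩ := L.relComplex_union_iso hP hQ (n + 1)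
  obtain ⟨h, hS⟩ := L.mayerVietoris_shortExact P Q
  obtain ⟨e'⟩ := homology_iso_of_acyclic_mid hS (prod_acyclic hLP hLQ) n
  exact ⟨e ≪≫ e'.symm⟩

/-- A 0-cocycle vanishing on `W` also vanishes on `P`, and degree 0 has no coboundaries to divide
by. -/
theorem relComplex_exactAt_zero_of_subset (L : LocalSystem X) {P W : Set X} (h : P ⊆ W)
    (hLP : (L.relComplex {P}).Acyclic) : (L.relComplex {W}).ExactAt 0 := by
  refine exactAt_zero fun c hc => ?_
  let g : L.relCochains {W} ⟶ L.relCochains {P} := L.relMono (by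
    rintro _ rfl
    exact ⟨W, rfl, h⟩)
  have h1 : (g.app _).hom c = 0 := diff_zero_injective hLP _ (by
    rw [← map_diff, hc, map_zero])
  exact Subtype.ext (congrArg (fun c : L.relSubmodule {P} _ => c.1) h1)

/-! ### A trivial line bundle relative to the complement of its zero section -/

section LineBundle

variable {Z : Type u} [TopologicalSpace Z] (L : LocalSystem (Z × ℂ))

/-- The straight-line homotopy towards `p` in each fibre ends in `D` and, by star-convexity, never
leaves `D`. -/
theorem relComplex_acyclic_of_starConvex {D : Set ℂ} {p : ℂ} (hp : p ∈ D)
    (hD : StarConvex ℝ p D) : (L.relComplex {Prod.snd ⁻¹' D}).Acyclic := by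
  refine L.relComplex_acyclic_of_deformation
    ⟨fun x : (Z × ℂ) × unitInterval =>
      (x.1.1, ((x.2 : ℝ) : ℂ) * p + ((1 - (x.2 : ℝ) : ℝ) : ℂ) * x.1.2), by fun_prop⟩ ?_ ?_ ?_
  · intro x
    exact Prod.ext rfl (by simp)
  · intro x
    change ((1 : ℝ) : ℂ) * p + ((1 - (1 : ℝ) : ℝ) : ℂ) * x.2 ∈ D
    simpa using hp
  · intro x hx t
    have := hD hx t.2.1 (sub_nonneg.2 t.2.2) (by ring)
    rw [Complex.real_smul, Complex.real_smul] at this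
    exact this

/-- The inclusion of the zero section of a trivial line bundle. -/
def zeroSection (Z : Type u) [TopologicalSpace Z] : C(Z, Z × ℂ) := ⟨fun z => (z, 0), by fun_prop⟩

theorem isEmbedding_zeroSection : Topology.IsEmbedding (zeroSection Z) :=
  Topology.IsEmbedding.of_leftInverse (f := Prod.fst) (fun _ => rfl) continuous_fst
    (zeroSection Z).continuous

theorem cohomology_zeroSection_iso (n : ℕ) :
    Nonempty (L.cohomology n ≅ (L.pullback (zeroSection Z)).cohomology n) := by
  obtain ⟨h, hS⟩ := L.pullback_shortExact (isEmbedding_zeroSection (Z := Z))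
  refine homology_iso_of_acyclic_left hS ?_ n
  have hr : Set.range (zeroSection Z) = Prod.snd ⁻¹' {(0 : ℂ)} := by
    ext ⟨z, w⟩
    constructor
    · rintro ⟨z', h⟩
      exact (congrArg Prod.snd h).symm
    · intro h
      exact ⟨z, Prod.ext rfl (Eq.symm h)⟩
  change (L.relComplex {Set.range (zeroSection Z)}).Acyclic
  rw [hr]
  exact L.relComplex_acyclic_of_starConvex rfl (starConvex_singleton _)

theorem slitPlane_union_neg :
    Complex.slitPlane ∪ -Complex.slitPlane = {w : ℂ | w ≠ 0} := by
  ext w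
  simp only [Set.mem_union, Set.mem_neg, Complex.mem_slitPlane_iff, Complex.neg_re, Complex.neg_im,
    Set.mem_ofPred_eq, ne_eq, Complex.ext_iff, Complex.zero_re, Complex.zero_im, neg_eq_zero,
    Left.neg_pos_iff]
  constructor
  · rintro ((h | h) | (h | h)) ⟨h1, h2⟩
    · exact h.ne' h1
    · exact h h2
    · exact h.ne h1
    · exact h h2
  · intro h
    by_cases h2 : w.im = 0
    · rcases lt_or_gt_of_ne fun h1 => h ⟨h1, h2⟩ with h1 | h1
      · exact Or.inr (Or.inl h1)
      · exact Or.inl (Or.inl h1)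
    · exact Or.inl (Or.inr h2)

theorem slitPlane_inter_neg :
    Complex.slitPlane ∩ -Complex.slitPlane = {w : ℂ | 0 < w.im} ∪ {w : ℂ | w.im < 0} := by
  ext w
  simp only [Set.mem_inter_iff, Set.mem_union, Set.mem_neg, Complex.mem_slitPlane_iff,
    Complex.neg_re, Complex.neg_im, Set.mem_ofPred_eq, ne_eq, neg_eq_zero, Left.neg_pos_iff]
  constructor
  · rintro ⟨h1, h2⟩
    by_contra! h
    have : w.im = 0 := le_antisymm h.1 h.2
    rcases h1 with h1 | h1 <;> rcases h2 with h2 | h2 <;> first | contradiction | linarith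
  · rintro (h | h)
    · exact ⟨Or.inr h.ne', Or.inr h.ne'⟩
    · exact ⟨Or.inr h.ne, Or.inr h.ne⟩

theorem relComplex_slitPlane_acyclic :
    (L.relComplex {Prod.snd ⁻¹' Complex.slitPlane}).Acyclic :=
  L.relComplex_acyclic_of_starConvex Complex.one_mem_slitPlane Complex.starConvex_one_slitPlane

theorem relComplex_neg_slitPlane_acyclic :
    (L.relComplex {Prod.snd ⁻¹' (-Complex.slitPlane)}).Acyclic :=
  L.relComplex_acyclic_of_starConvex (p := -1) (by simp) Complex.starConvex_one_slitPlane.neg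

theorem relComplex_upper_acyclic : (L.relComplex {Prod.snd ⁻¹' {w : ℂ | 0 < w.im}}).Acyclic :=
  L.relComplex_acyclic_of_starConvex (p := Complex.I) (by simp)
    ((convex_halfSpace_im_gt 0).starConvex (by simp))

theorem relComplex_lower_acyclic : (L.relComplex {Prod.snd ⁻¹' {w : ℂ | w.im < 0}}).Acyclic :=
  L.relComplex_acyclic_of_starConvex (p := -Complex.I) (by simp)
    ((convex_halfSpace_im_lt 0).starConvex (by simp))

theorem relComplex_punctured_iso (n : ℕ) :
    Nonempty ((L.relComplex {Prod.snd ⁻¹' {w : ℂ | w ≠ 0}}).homology (n + 1) ≅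
      (L.relComplex {Prod.snd ⁻¹' ({w : ℂ | 0 < w.im} ∪ {w : ℂ | w.im < 0})}).homology n) := by
  rw [← slitPlane_union_neg, ← slitPlane_inter_neg]
  exact L.relComplex_union_iso_inter (Complex.isOpen_slitPlane.preimage continuous_snd)
    (Complex.isOpen_slitPlane.neg.preimage continuous_snd) L.relComplex_slitPlane_acyclic
    L.relComplex_neg_slitPlane_acyclic n

/-- The half-planes are disjoint, so Mayer–Vietoris ends at cohomology relative to the empty set,
which is the absolute cohomology of `Z × ℂ`. -/
theorem relComplex_nonreal_iso (n : ℕ) :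
    Nonempty ((L.relComplex
      {Prod.snd ⁻¹' ({w : ℂ | 0 < w.im} ∪ {w : ℂ | w.im < 0})}).homology (n + 1) ≅
      (L.pullback (zeroSection Z)).cohomology n) := by
  obtain ⟨e⟩ := L.relComplex_union_iso_inter
    ((isOpen_lt continuous_const Complex.continuous_im).preimage continuous_snd)
    ((isOpen_lt Complex.continuous_im continuous_const).preimage continuous_snd)
    L.relComplex_upper_acyclic L.relComplex_lower_acyclic n
  obtain ⟨e'⟩ := L.cohomology_zeroSection_iso n
  have h : (Prod.snd ⁻¹' {w : ℂ | 0 < w.im} ∩ Prod.snd ⁻¹' {w : ℂ | w.im < 0} :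
      Set (Z × ℂ)) = ∅ := by
    ext x
    simp only [Set.mem_inter_iff, Set.mem_preimage, Set.mem_ofPred_eq, Set.mem_empty_iff_false,
      iff_false, not_and, not_lt]
    exact le_of_lt
  rw [h] at e
  have := L.isIso_relInclusion_empty
  exact ⟨e ≪≫ (HomologicalComplex.homologyFunctor _ _ n).mapIso
    (asIso (complexMap (L.relInclusion {∅}))) ≪≫ e'⟩

end LineBundle

/-- The Thom isomorphism for a closed subspace `Z` with a trivialized tubular neighbourhood `e`
and complement `U`. -/
theorem relComplex_thom (L : LocalSystem X) {Z : Type u} [TopologicalSpace Z] {e : C(Z × ℂ, X)}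
    (he : Topology.IsOpenEmbedding e) {U : Set X} (hU : IsOpen U)
    (heU : e ⁻¹' U = Prod.snd ⁻¹' {w : ℂ | w ≠ 0}) (hcov : ∀ x, x ∈ U ∨ x ∈ Set.range e) :
    (L.relComplex {U}).ExactAt 0 ∧ (L.relComplex {U}).ExactAt 1 ∧ ∀ n,
      Nonempty ((L.relComplex {U}).homology (n + 2) ≅
        ((L.pullback e).pullback (zeroSection Z)).cohomology n) := by
  have key : ∀ n, Nonempty ((L.relComplex {U}).homology n ≅
      ((L.pullback e).relComplex {Prod.snd ⁻¹' {w : ℂ | w ≠ 0}}).homology n) := by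
    -- Excision: the kernel of restriction to the tube consists of the cochains vanishing on `U` and
    -- on the tube, an open cover of `X`.
    obtain ⟨h, hS⟩ := L.relPullback_shortExact (f := e) he.isEmbedding
      (𝒲 := {U, Set.range e}) (𝒰 := {U}) (𝒱 := {Prod.snd ⁻¹' {w : ℂ | w ≠ 0}})
      (by
        rintro _ rfl
        exact ⟨_, Or.inl rfl, le_rfl⟩)
      ⟨_, Or.inr rfl, le_rfl⟩
      (by
        rintro _ (rfl | rfl)
        · exact Or.inl ⟨_, rfl, le_rfl⟩
        · exact Or.inr le_rfl)
      (by
        rintro _ rfl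
        exact ⟨U, rfl, heU.ge⟩)
      (by
        rintro _ rfl
        exact ⟨_, rfl, heU.le⟩)
    refine homology_iso_of_acyclic_left hS (L.relComplex_acyclic_of_cover ?_ fun x => ?_)
    · rintro _ (rfl | rfl)
      · exact hU
      · exact he.isOpen_range
    · obtain hx | hx := hcov x
      · exact ⟨_, Or.inl rfl, hx⟩
      · exact ⟨_, Or.inr rfl, hx⟩
  refine ⟨?_, ?_, fun n => ?_⟩
  · obtain ⟨i⟩ := key 0
    rw [HomologicalComplex.exactAt_iff_isZero_homology]
    refine Limits.IsZero.of_iso ?_ i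
    refine ((L.pullback e).relComplex_exactAt_zero_of_subset ?_
      (L.pullback e).relComplex_slitPlane_acyclic).isZero_homology
    rw [← slitPlane_union_neg]
    exact Set.preimage_mono Set.subset_union_left
  · obtain ⟨i⟩ := key 1
    obtain ⟨i'⟩ := (L.pullback e).relComplex_punctured_iso 0
    rw [HomologicalComplex.exactAt_iff_isZero_homology]
    refine Limits.IsZero.of_iso ?_ (i ≪≫ i')
    exact ((L.pullback e).relComplex_exactAt_zero_of_subset
      (Set.preimage_mono Set.subset_union_left)
      (L.pullback e).relComplex_upper_acyclic).isZero_homology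
  · obtain ⟨i⟩ := key (n + 2)
    obtain ⟨i'⟩ := (L.pullback e).relComplex_punctured_iso (n + 1)
    obtain ⟨i''⟩ := (L.pullback e).relComplex_nonreal_iso n
    exact ⟨i ≪≫ i' ≪≫ i''⟩

/-- An equality of functors, not just an isomorphism, so the target of the Thom isomorphism can
simply be rewritten. -/
theorem pullback_comp {Y Z : Type u} [TopologicalSpace Y] [TopologicalSpace Z]
    (L : LocalSystem X) (f : C(Y, X)) (g : C(Z, Y)) :
    (L.pullback f).pullback g = L.pullback (f.comp g) := by
  refine CategoryTheory.Functor.ext (fun _ => rfl) fun x y p => ?_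
  induction p using Quotient.inductionOn
  simp
  rfl

/-- The Gysin sequence in local system cohomology of a closed subspace `Z` with a trivialized
tubular neighbourhood `e` and with open complement `Y`. -/
theorem gysin_exact (L : LocalSystem X) {Y Z : Type u} [TopologicalSpace Y] [TopologicalSpace Z]
    {i : C(Y, X)} (hi : Topology.IsOpenEmbedding i) {j : C(Z, X)} {e : C(Z × ℂ, X)}
    (he : Topology.IsOpenEmbedding e) (hej : ∀ z, e (z, 0) = j z)
    (hei : ∀ p, e p ∈ Set.range i ↔ p.2 ≠ 0) (hcov : ∀ x, x ∈ Set.range i ∨ x ∈ Set.range e) :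
    ∃ (ρ : ∀ q : ℕ, (L.pullback i).cohomology (q + 1) →ₗ[ℂ] (L.pullback j).cohomology q)
      (δ : ∀ q : ℕ, (L.pullback j).cohomology q →ₗ[ℂ] L.cohomology (q + 2)),
      Function.Bijective (L.cohomologyPullback i 0) ∧
      Function.Injective (L.cohomologyPullback i 1) ∧
      ∀ q : ℕ, Function.Exact (L.cohomologyPullback i (q + 1)) (ρ q) ∧
        Function.Exact (ρ q) (δ q) ∧ Function.Exact (δ q) (L.cohomologyPullback i (q + 2)) := by
  obtain rfl : e.comp (zeroSection Z) = j := ContinuousMap.ext hej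
  rw [← pullback_comp]
  obtain ⟨h0, h1, hθ⟩ := L.relComplex_thom he hi.isOpen_range (Set.ext hei) hcov
  -- Only exactness is claimed, so an arbitrary choice of isomorphism in each degree is enough. It
  -- is used in `ρ`, and its inverse in `δ`.
  obtain ⟨θ⟩ : Nonempty (∀ n, (L.relComplex {Set.range i}).homology (n + 2) ≅
    ((L.pullback e).pullback (zeroSection Z)).cohomology n) := ⟨fun n => (hθ n).some⟩
  obtain ⟨h, hS⟩ := L.pullback_shortExact (f := i) hi.isEmbedding
  have ex1 : ∀ q : ℕ, Function.Exact (L.cohomologyPullback i q) (hS.δ q (q + 1) rfl).hom :=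
    fun q => (ShortComplex.ShortExact.moduleCat_exact_iff_function_exact _).1
      (hS.homology_exact₃ q (q + 1) rfl)
  have ex2 : ∀ q : ℕ, Function.Exact (hS.δ q (q + 1) rfl).hom
      (HomologicalComplex.homologyMap (complexMap (L.relInclusion {Set.range i})) (q + 1)).hom :=
    fun q => (ShortComplex.ShortExact.moduleCat_exact_iff_function_exact _).1
      (hS.homology_exact₁ q (q + 1) rfl)
  have ex3 : ∀ q : ℕ, Function.Exact
      (HomologicalComplex.homologyMap (complexMap (L.relInclusion {Set.range i})) q).hom
      (L.cohomologyPullback i q) :=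
    fun q => (ShortComplex.ShortExact.moduleCat_exact_iff_function_exact _).1
      (hS.homology_exact₂ q)
  have hinj : ∀ q, (L.relComplex {Set.range i}).ExactAt q →
      Function.Injective (L.cohomologyPullback i q) := fun q hq => by
    rw [injective_iff_map_eq_zero]
    intro x hx
    obtain ⟨y, rfl⟩ := (ex3 q x).1 hx
    have : Subsingleton ((L.relComplex {Set.range i}).homology q) :=
      ModuleCat.subsingleton_of_isZero hq.isZero_homology
    rw [Subsingleton.elim y 0]
    exact map_zero _
  refine ⟨fun q => (θ q).toLinearEquiv.toLinearMap ∘ₗ (hS.δ (q + 1) (q + 2) rfl).hom,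
    fun q => (HomologicalComplex.homologyMap
      (complexMap (L.relInclusion {Set.range i})) (q + 2)).hom ∘ₗ
        (θ q).toLinearEquiv.symm.toLinearMap, ⟨hinj 0 h0, fun x => ?_⟩, hinj 1 h1,
    fun q => ⟨fun x => ?_, fun x => ?_, fun x => ?_⟩⟩
  · refine (ex1 0 x).1 ?_
    have : Subsingleton ((L.relComplex {Set.range i}).homology 1) :=
      ModuleCat.subsingleton_of_isZero h1.isZero_homology
    exact Subsingleton.elim (α := (L.relComplex {Set.range i}).homology 1) _ _
  · rw [← ex1 (q + 1) x]
    exact (θ q).toLinearEquiv.map_eq_zero_iff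
  · refine (ex2 (q + 1) ((θ q).toLinearEquiv.symm x)).trans ?_
    refine exists_congr fun y => ?_
    exact (θ q).toLinearEquiv.toEquiv.eq_symm_apply
  · refine (ex3 (q + 2) x).trans ?_
    constructor
    · rintro ⟨y, rfl⟩
      refine ⟨(θ q).toLinearEquiv y, ?_⟩
      exact congrArg _ ((θ q).toLinearEquiv.symm_apply_apply y)
    · rintro ⟨y, rfl⟩
      exact ⟨_, rfl⟩

end LocalSystem

/-! ### Tubular neighbourhoods of hyperplanes -/

section Tube

open Topology

variable {V : Type*} [NormedAddCommGroup V]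

theorem IsOpen.exists_continuous_ball_subset {X : Set V} (hX : IsOpen X) :
    ∃ ε : V → ℝ, Continuous ε ∧ ∀ x ∈ X, 0 < ε x ∧ Metric.ball x (ε x) ⊆ X := by
  -- The distance to the empty set is 0 by convention, so the case where `X` is the whole space
  -- needs a separate, constant radius.
  by_cases h : (Xᶜ).Nonempty
  · refine ⟨fun x => Metric.infDist x Xᶜ, Metric.continuous_infDist_pt _, fun x hx => ⟨?_, ?_⟩⟩
    · exact (hX.isClosed_compl.notMem_iff_infDist_pos h).1 fun hx' => hx' hx
    · intro y hy
      by_contra hy'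
      refine (Metric.infDist_le_dist_of_mem (x := x) (s := Xᶜ) hy').not_gt ?_
      rwa [dist_comm]
  · refine ⟨fun _ => 1, continuous_const, fun x _ => ⟨one_pos, fun y _ => ?_⟩⟩
    by_contra hy
    exact h ⟨y, hy⟩

variable [NormedSpace ℂ V]

/-- The decomposition of `V` into an affine hyperplane and a transversal line. -/
def hyperplaneProdLine (φ : V →L[ℂ] ℂ) (p n : V) (hn : φ n = 1) :
    {x : V | φ (x - p) = 0} × ℂ ≃ₜ V where
  toFun x := x.1 + x.2 • n
  invFun x := (⟨x - φ (x - p) • n, by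
    change φ (x - φ (x - p) • n - p) = 0
    rw [sub_right_comm, map_sub, map_smul, hn, smul_eq_mul, mul_one, sub_self]⟩, φ (x - p))
  left_inv := by
    rintro ⟨⟨x, hx⟩, t⟩
    have h : φ (x + t • n - p) = t := by
      have h0 : φ (x - p) = 0 := hx
      rw [add_sub_right_comm, map_add, h0, map_smul, hn, zero_add, smul_eq_mul, mul_one]
    refine Prod.ext (Subtype.ext ?_) h
    change x + t • n - φ (x + t • n - p) • n = x
    rw [h, add_sub_cancel_right]
  right_inv x := sub_add_cancel _ _
  continuous_toFun := by fun_prop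
  continuous_invFun := by fun_prop

/-- A trivialized tubular neighbourhood of the hyperplane section `Z` of the open set `X`. -/
theorem exists_tubular_neighbourhood {X Z : Set V} (hX : IsOpen X) (φ : V →L[ℂ] ℂ) (p n : V)
    (hn : φ n = 1) (hZ : Z = X ∩ {x | φ (x - p) = 0}) :
    ∃ e : C(Z × ℂ, X), IsOpenEmbedding e ∧ (∀ z, (e (z, 0) : V) = z) ∧
      ∀ q, φ ((e q : V) - p) = 0 ↔ q.2 = 0 := by
  have hZX : Z ⊆ X := hZ.trans_subset Set.inter_subset_left
  have hZH : Z ⊆ {x | φ (x - p) = 0} := hZ.trans_subset Set.inter_subset_right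
  have hn0 : n ≠ 0 := by
    rintro rfl
    simp at hn
  have hn' : 0 < ‖n‖ := norm_pos_iff.2 hn0
  obtain ⟨ε, hε, hεX⟩ := hX.exists_continuous_ball_subset
  have hεC : ∀ z : Z, (ε z : ℂ) / ‖n‖ ≠ 0 := fun z =>
    div_ne_zero (Complex.ofReal_ne_zero.2 (hεX z (hZX z.2)).1.ne')
      (Complex.ofReal_ne_zero.2 hn'.ne')
  let scale : Z × ℂ ≃ₜ Z × ℂ :=
    { toFun := fun q => (q.1, (ε q.1 : ℂ) / ‖n‖ * q.2)
      invFun := fun q => (q.1, ((ε q.1 : ℂ) / ‖n‖)⁻¹ * q.2)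
      left_inv := fun q => Prod.ext rfl (inv_mul_cancel_left₀ (hεC q.1) _)
      right_inv := fun q => Prod.ext rfl (mul_inv_cancel_left₀ (hεC q.1) _)
      continuous_toFun := by fun_prop
      continuous_invFun := by
        refine Continuous.prodMk (by fun_prop) (Continuous.mul (Continuous.inv₀ ?_ ?_) (by fun_prop))
        · fun_prop
        · exact fun q => hεC q.1 }
  let g : ℂ → ℂ := fun w => (Homeomorph.unitBall w : ℂ)
  have hg : IsOpenEmbedding g :=
    Metric.isOpen_ball.isOpenEmbedding_subtypeVal.comp Homeomorph.unitBall.isOpenEmbedding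
  have hg0 : g 0 = 0 := Homeomorph.coe_unitBall_apply_zero
  have hincl : IsOpenEmbedding (Set.inclusion hZH) := by
    refine ⟨IsEmbedding.inclusion hZH, ?_⟩
    rw [Set.range_inclusion]
    convert hX.preimage continuous_subtype_val using 1
    ext x
    change (x : V) ∈ Z ↔ (x : V) ∈ X
    rw [hZ]
    exact and_iff_left x.2
  -- The map `g` squeezes `ℂ` into the unit disc. Dividing by `‖n‖` keeps the displacement from `z`
  -- below `ε z`, hence inside `X`.
  let E : Z × ℂ → V := fun q => q.1 + ((ε q.1 : ℂ) / ‖n‖ * g q.2) • n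
  have hE : IsOpenEmbedding E :=
    (hyperplaneProdLine φ p n hn).isOpenEmbedding.comp
      ((hincl.prodMap IsOpenEmbedding.id).comp
        (scale.isOpenEmbedding.comp (IsOpenEmbedding.id.prodMap hg)))
  have hEX : ∀ q, E q ∈ X := fun q => by
    refine (hεX q.1 (hZX q.1.2)).2 ?_
    have h1 : ‖g q.2‖ < 1 := mem_ball_zero_iff.1 (Homeomorph.unitBall q.2).2
    have h2 := (hεX q.1 (hZX q.1.2)).1
    rw [Metric.mem_ball, dist_eq_norm, add_sub_cancel_left, norm_smul, norm_mul, norm_div,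
      Complex.norm_real, Complex.norm_real, norm_norm, Real.norm_of_nonneg h2.le]
    calc ε q.1 / ‖n‖ * ‖g q.2‖ * ‖n‖ = ε q.1 * ‖g q.2‖ := by field_simp
      _ < ε q.1 * 1 := by gcongr
      _ = ε q.1 := mul_one _
  refine ⟨⟨fun q => ⟨E q, hEX q⟩, hE.continuous.subtype_mk _⟩, ?_, fun z => ?_, fun q => ?_⟩
  · exact IsOpenEmbedding.of_comp _ hX.isOpenEmbedding_subtypeVal hE
  · change (z : V) + (_ * g 0) • n = z
    rw [hg0, mul_zero, zero_smul, add_zero]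
  · change φ ((q.1 : V) + ((ε q.1 : ℂ) / ‖n‖ * g q.2) • n - p) = 0 ↔ _
    have h0 : φ ((q.1 : V) - p) = 0 := hZH q.1.2
    rw [add_sub_right_comm, map_add, h0, map_smul, hn, zero_add, smul_eq_mul, mul_one, mul_eq_zero,
      or_iff_right (hεC q.1)]
    exact hg.injective.eq_iff' hg0

end Tube

namespace AffineSubspace

/-- An affine hyperplane is the zero set of an affine form. -/
theorem exists_eq_zeroSet {V : Type*} [AddCommGroup V] [Module ℂ V] [FiniteDimensional ℂ V]
    {H : AffineSubspace ℂ V} (hne : (H : Set V).Nonempty)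
    (hH : Module.finrank ℂ H.direction + 1 = Module.finrank ℂ V) :
    ∃ (φ : V →ₗ[ℂ] ℂ) (p n : V), φ n = 1 ∧ (H : Set V) = {x | φ (x - p) = 0} := by
  obtain ⟨p, hp⟩ := hne
  have hlt : H.direction < ⊤ := by
    refine lt_top_iff_ne_top.2 fun h => ?_
    rw [h, finrank_top] at hH
    omega
  obtain ⟨φ, hφ, hle⟩ := Submodule.exists_le_ker_of_lt_top _ hlt
  obtain ⟨m, hm⟩ : ∃ m, φ m ≠ 0 := by
    by_contra! h
    exact hφ (LinearMap.ext h)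
  have hker : H.direction = LinearMap.ker φ := by
    refine Submodule.eq_of_le_of_finrank_eq hle ?_
    have h1 := LinearMap.finrank_range_add_finrank_ker φ
    rw [LinearMap.range_eq_top.2 (LinearMap.surjective hφ), finrank_top, Module.finrank_self] at h1
    omega
  refine ⟨φ, p, (φ m)⁻¹ • m, ?_, ?_⟩
  · rw [map_smul, smul_eq_mul, inv_mul_cancel₀ hm]
  · ext x
    change x ∈ H ↔ φ (x - p) = 0
    rw [← LinearMap.mem_ker, ← hker, ← vsub_eq_sub, AffineSubspace.vsub_right_mem_direction_iff_mem hp]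

end AffineSubspace

theorem Arrangement.isOpen_complement {ℓ : ℕ}
    (A : Arrangement (⊤ : AffineSubspace ℂ (Fin ℓ → ℂ))) : IsOpen A.complement := by
  rw [Arrangement.complement]
  refine IsOpen.sdiff isOpen_univ (A.finite.isClosed_biUnion fun K _ => ?_)
  exact K.closed_of_finiteDimensional

end

/-! ### The exact sequence of the triple -/

theorem theorem2p2 {ℓ : ℕ} (A : Arrangement (⊤ : AffineSubspace ℂ (Fin ℓ → ℂ)))
    (H : AffineSubspace ℂ (Fin ℓ → ℂ)) (hH : H ∈ A.hyperplanes)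
    (L' : LocalSystem (A.deletion H).complement) (hL' : L'.IsRankOne) :
    ∃ (ρ : ∀ q : ℕ, ((L'.pullback (A.inclusionDeletion H hH)).cohomology (q + 1)) →ₗ[ℂ]
          ((L'.pullback (A.inclusionRestriction H hH)).cohomology q))
      (δ : ∀ q : ℕ, ((L'.pullback (A.inclusionRestriction H hH)).cohomology q) →ₗ[ℂ]
          (L'.cohomology (q + 2))),
      Function.Bijective (L'.cohomologyPullback (A.inclusionDeletion H hH) 0) ∧
      Function.Injective (L'.cohomologyPullback (A.inclusionDeletion H hH) 1) ∧
      ∀ q : ℕ,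
        Function.Exact (L'.cohomologyPullback (A.inclusionDeletion H hH) (q + 1)) (ρ q) ∧
        Function.Exact (ρ q) (δ q) ∧
        Function.Exact (δ q) (L'.cohomologyPullback (A.inclusionDeletion H hH) (q + 2)) := by
  obtain ⟨φ, p, n, hn, hHφ⟩ := AffineSubspace.exists_eq_zeroSet (A.nonempty H hH) (by
    have h := A.codim_one H hH
    rwa [AffineSubspace.direction_top, finrank_top] at h)
  obtain ⟨e, he, he0, heφ⟩ := exists_tubular_neighbourhood (A.deletion H).isOpen_complement
    φ.toContinuousLinearMap p n hn (Z := (A.restriction H hH).complement)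
    (by rw [A.complement_restriction_eq H hH, hHφ]; rfl)
  have hrange : ∀ x, x ∈ Set.range (A.inclusionDeletion H hH) ↔ (x : Fin ℓ → ℂ) ∉ H := by
    intro x
    constructor
    · rintro ⟨y, rfl⟩
      exact ((A.complement_eq H hH).le y.2).2
    · intro hx
      exact ⟨⟨x, (A.complement_eq H hH).ge ⟨x.2, hx⟩⟩, rfl⟩
  have hφH : ∀ x, x ∈ H ↔ φ (x - p) = 0 := fun x => Set.ext_iff.1 hHφ x
  refine L'.gysin_exact ?_ he (fun z => Subtype.ext (he0 z)) (fun q => ?_) (fun x => ?_)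
  · exact Topology.IsOpenEmbedding.of_comp _
      (A.deletion H).isOpen_complement.isOpenEmbedding_subtypeVal
      A.isOpen_complement.isOpenEmbedding_subtypeVal
  · rw [hrange, hφH]
    exact (heφ q).not
  · rw [hrange]
    by_cases hx : (x : Fin ℓ → ℂ) ∈ H
    · have hxZ : (x : Fin ℓ → ℂ) ∈ (A.restriction H hH).complement := by
        rw [A.complement_restriction_eq H hH]
        exact ⟨x.2, hx⟩
      exact Or.inr ⟨(⟨x, hxZ⟩, 0), Subtype.ext (he0 _)⟩
    · exact Or.inl hx
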